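/- Let $\|\cdot\|$ be the Euclidean norm on $\mathbb R^2$. For a full-rank lattice $\Lambda\subset\mathbb R^2$ let $|\Lambda|=\min\{\|x\|: x\in\Lambda\setminus\{0\}\}$, let $\det(\Lambda)$ be its covolume, and call $\Lambda$ well-rounded if its minimal vectors $\{x\in\Lambda:\|x\|=|\Lambda|\}$ span $\mathbb R^2$ over $\mathbb{R}$. Let $\operatorname{WR}(\mathbb Z^2)$ be the set of full-rank well-rounded sublattices of $\mathbb Z^2$. Two lattices are similar if $\Lambda_1=\alpha U\Lambda_2$ with $\alpha>0$, $U\in O_2(\mathbb R)$; let $\mathcal C_2$ be the set of similarity classes of lattices in $\operatorname{WR}(\mathbb Z^2)$, each regarded as a subset of $\operatorname{WR}(\mathbb Z^2)$. A shortest basis of $\Lambda$ is a basis $x,y$ of $\Lambda$ such that $x$ is a minimal vector and $y$ has the least norm among the vectors that complete $x$ to a basis of $\Lambda$. Let $\theta(\Lambda)\in[\pi/3,\pi/2]$ be the minimum of $\arccos\bigl(|x\cdot y|/(\|x\|\|y\|)\bigr)$ over all shortest bases $x,y$ of $\Lambda$. Let $\mathcal S$ be the set of fractions $p/q$ with $p,q$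 positive integers, $\gcd(p,q)=1$, $\sqrt3/2<p/q<1$ and $\sqrt{q^2-p^2}\in\mathbb Z$, together with $1=1/1$. Every class in $\mathcal C_2$ is of the form $$C(p,q)=\{\Lambda\in\operatorname{WR}(\mathbb Z^2):\sin\theta(\Lambda)=p/q\}$$ for exactly one $p/q\in\mathcal S$ (in lowest terms); $p$ is called its determinant weight and $q$ its minima weight. Let $a_p$ be the number of classes in $\mathcal C_2$ with determinant weight $p$ and $b_q$ the number of those with minima weight $q$, and put $$W_d(s)=\sum_{C(p,q)\in\mathcal C_2}p^{-s}=\sum_{p\ge1}a_p\,p^{-s},\qquad W_m(s)=\sum_{C(p,q)\in\mathcal C_2}q^{-s}=\sum_{q\ge1}b_q\,q^{-s},$$ $$\zeta_{\operatorname{WR}(\mathbb Z^2)}(s)=\sum_{\Lambda\in\operatorname{WR}(\mathbb Z^2)}\det(\Lambda)^{-s},\qquad \zeta^m_{\operatorname{WR}(\mathbb Z^2)}(s)=\sum_{\Lambda\in\operatorname{WR}(\mathbb Z^2)}|\Lambda|^{-2s}.$$ The last two are regarded as Dirichlet series $\sum_{n\ge1}c_nn^{-s}$, where $c_n$ is the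 number of $\Lambda\in\operatorname{WR}(\mathbb Z^2)$ with $\det(\Lambda)=n$, respectively $|\Lambda|^2=n$. For real $\mu,s_0>0$, a Dirichlet series $\sum_{n\ge1}c_nn^{-s}$ is said to have a pole of order $\mu$ at $s=s_0$ if $\lim_{s\to s_0^+}|s-s_0|^{\mu}\sum_{n\ge1}|c_nn^{-s}|$ exists and is positive and finite (no analytic continuation is implied). A simple pole is one of order $1$. **Theorem.** The series $W_d(s)$ and $W_m(s)$ converge absolutely and are analytic for all $s\in\mathbb C$ with $\operatorname{Re}s>1$, and both have simple poles at $s=1$. The series $\zeta_{\operatorname{WR}(\mathbb Z^2)}(s)$ and $\zeta^m_{\operatorname{WR}(\mathbb Z^2)}(s)$ converge absolutely and are analytic for all $s\in\mathbb C$ with $\operatorname{Re}s>1$, and both have poles of order two at $s=1$. -/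

import Mathlib

open Filter Topology

/-- The integer lattice `ℤ^N` inside Euclidean space. -/
noncomputable def intLattice (N : ℕ) : Submodule ℤ (EuclideanSpace ℝ (Fin N)) :=
  Submodule.span ℤ (Set.range (EuclideanSpace.basisFun (Fin N) ℝ))

/-- The minimum `|Λ|` of a lattice: the least Euclidean norm of a nonzero vector. -/
noncomputable def latticeMin {N : ℕ} (L : Submodule ℤ (EuclideanSpace ℝ (Fin N))) : ℝ :=
  sInf {r : ℝ | ∃ x ∈ L, x ≠ 0 ∧ r = ‖x‖}

/-- The set `S(Λ)` of minimal vectors. -/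
def minVectors {N : ℕ} (L : Submodule ℤ (EuclideanSpace ℝ (Fin N))) :
    Set (EuclideanSpace ℝ (Fin N)) :=
  {x | x ∈ L ∧ ‖x‖ = latticeMin L}

/-- A lattice is well-rounded if its minimal vectors span the whole space over `ℝ`. -/
def IsWellRounded {N : ℕ} (L : Submodule ℤ (EuclideanSpace ℝ (Fin N))) : Prop :=
  Submodule.span ℝ (minVectors L) = ⊤

/-- `WR(Ω)`: the set of full-rank well-rounded sublattices of the lattice `Ω`. -/
def wrSublattices {N : ℕ} (Ω : Submodule ℤ (EuclideanSpace ℝ (Fin N))) :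
    Set (Submodule ℤ (EuclideanSpace ℝ (Fin N))) :=
  {L | L ≤ Ω ∧ Submodule.span ℝ (L : Set (EuclideanSpace ℝ (Fin N))) = ⊤ ∧ IsWellRounded L}

/-- `L₁ = α U L₂` for some `α > 0` and some orthogonal transformation `U`. -/
def LatticeSimilar {N : ℕ} (L₁ L₂ : Submodule ℤ (EuclideanSpace ℝ (Fin N))) : Prop :=
  ∃ (α : ℝ) (U : EuclideanSpace ℝ (Fin N) ≃ₗᵢ[ℝ] EuclideanSpace ℝ (Fin N)), 0 < α ∧
    (L₁ : Set (EuclideanSpace ℝ (Fin N))) =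
      (fun x => α • U x) '' (L₂ : Set (EuclideanSpace ℝ (Fin N)))

/-- `WR(ℤ²)`. -/
noncomputable abbrev WRZ2 : Set (Submodule ℤ (EuclideanSpace ℝ (Fin 2))) :=
  wrSublattices (intLattice 2)

/-- `𝒞₂`: the similarity classes of lattices in `WR(ℤ²)`, as subsets of `WR(ℤ²)`. -/
def simClasses : Set (Set (Submodule ℤ (EuclideanSpace ℝ (Fin 2)))) :=
  {C | ∃ L ∈ WRZ2, C = {L' | L' ∈ WRZ2 ∧ LatticeSimilar L' L}}

/-- `x, y` is a shortest basis of `L`: `x` is a minimal vector, and `y` has the smallest norm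
among all vectors that complete `x` to a basis of `L`. -/
def IsShortestBasis (L : Submodule ℤ (EuclideanSpace ℝ (Fin 2)))
    (x y : EuclideanSpace ℝ (Fin 2)) : Prop :=
  x ∈ minVectors L ∧ Submodule.span ℤ {x, y} = L ∧
    ∀ y', Submodule.span ℤ {x, y'} = L → ‖y‖ ≤ ‖y'‖

/-- The angle `θ(Λ)` (in `[π/3, π/2]` for a planar lattice): the least non-obtuse angle between
the lines spanned by the vectors of a shortest basis. -/
noncomputable def latticeAngle (L : Submodule ℤ (EuclideanSpace ℝ (Fin 2))) : ℝ :=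
  sInf {t : ℝ | ∃ x y, IsShortestBasis L x y ∧
    t = Real.arccos (|inner ℝ x y| / (‖x‖ * ‖y‖))}

/-- The pairs `(p, q)` in lowest terms for which `p/q` belongs to `𝒮`. -/
def fareyPairs : Set (ℕ × ℕ) :=
  {z | 0 < z.2 ∧ Nat.gcd z.1 z.2 = 1 ∧ Real.sqrt 3 / 2 < (z.1 : ℝ) / z.2 ∧
      (z.1 : ℝ) / z.2 < 1 ∧ ∃ t : ℕ, Real.sqrt ((z.2 : ℝ) ^ 2 - (z.1 : ℝ) ^ 2) = t} ∪ {(1, 1)}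

/-- The class `C(p,q)` of lattices in `WR(ℤ²)` with `sin θ(Λ) = p/q`. -/
def classOf (p q : ℕ) : Set (Submodule ℤ (EuclideanSpace ℝ (Fin 2))) :=
  {L | L ∈ WRZ2 ∧ Real.sin (latticeAngle L) = (p : ℝ) / q}

/-- The determinant weight of a class: the (unique) `p` such that the class is `C(p,q)` for some
`p/q ∈ 𝒮`. -/
noncomputable def detWeight (C : Set (Submodule ℤ (EuclideanSpace ℝ (Fin 2)))) : ℕ :=
  sInf {p | ∃ q, (p, q) ∈ fareyPairs ∧ C = classOf p q}

/-- The minima weight of a class: the (unique) `q` such that the class is `C(p,q)` for some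
`p/q ∈ 𝒮`. -/
noncomputable def minWeight (C : Set (Submodule ℤ (EuclideanSpace ℝ (Fin 2)))) : ℕ :=
  sInf {q | ∃ p, (p, q) ∈ fareyPairs ∧ C = classOf p q}

/-- The term `N(x)^{-s}`; the four series below are the sums of such terms over `𝒞₂` with
`N` a weight, and over `WR(ℤ²)` with `N` the determinant (covolume) or the squared minimum. -/
noncomputable def normTerm {X : Type*} (N : X → ℝ) (s : ℂ) (x : X) : ℂ :=
  (N x : ℂ) ^ (-s)

/-- The sum `∑_x N(x)^{-s}`. -/
noncomputable def normSeries {X : Type*} (N : X → ℝ) (s : ℂ) : ℂ := ∑' x, normTerm N s x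

/-- The coefficient `c_n = #{x : N(x) = n}` of `n^{-s}` in `∑_x N(x)^{-s}`. -/
noncomputable def normCoeff {X : Type*} (N : X → ℝ) (n : ℕ) : ℂ :=
  (Nat.card {x : X // N x = n} : ℂ)

/-- The determinant weights on `𝒞₂`; then `W_d(s) = normSeries classDet s`, and
`a_p = normCoeff classDet p`. -/
noncomputable def classDet (C : simClasses) : ℝ := detWeight C

/-- The minima weights on `𝒞₂`; then `W_m(s) = normSeries classMin s`, and
`b_q = normCoeff classMin q`. -/
noncomputable def classMin (C : simClasses) : ℝ := minWeight C

/-- The determinant on `WR(ℤ²)`. -/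
noncomputable def wrDet (L : WRZ2) : ℝ :=
  ZLattice.covolume (L : Submodule ℤ (EuclideanSpace ℝ (Fin 2)))

/-- The squared minimum on `WR(ℤ²)`. -/
noncomputable def wrMinSq (L : WRZ2) : ℝ :=
  latticeMin (L : Submodule ℤ (EuclideanSpace ℝ (Fin 2))) ^ 2

/-- `W_d(s)`, the determinant weight enumerator. -/
noncomputable def weightD (s : ℂ) : ℂ := normSeries classDet s

/-- `W_m(s)`, the minima weight enumerator. -/
noncomputable def weightM (s : ℂ) : ℂ := normSeries classMin s

/-- `ζ_{WR(ℤ²)}(s)`, the sum of `det(Λ)^{-s}` over `WR(ℤ²)`. -/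
noncomputable def zetaWR (s : ℂ) : ℂ := normSeries wrDet s

/-- `ζ^m_{WR(ℤ²)}(s)`, the sum of `|Λ|^{-2s}` over `WR(ℤ²)`. -/
noncomputable def zetaWRMin (s : ℂ) : ℂ := normSeries wrMinSq s

/-- For all `s` with `Re s > σ`, the sum `∑_x N(x)^{-s}` converges (absolutely) and equals the
Dirichlet series `∑_{n ≥ 1} c_n n^{-s}`, `c_n = #{x : N(x) = n}`; this includes the finiteness of
the sets counted by `c_n`. -/
def ConvergesRightOf {X : Type*} (N : X → ℝ) (σ : ℝ) : Prop :=
  (∀ n : ℕ, Finite {x : X // N x = n}) ∧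
    ∀ s : ℂ, σ < s.re →
      Summable (normTerm N s) ∧ LSeriesHasSum (normCoeff N) s (normSeries N s)

/-- The Dirichlet series `∑_{n ≥ 1} c_n n^{-s}` has a pole of order `μ` at `s = s₀`, in the sense
of growth: `|s - s₀|^μ ∑ |c_n n^{-s}|` has a finite positive limit as `s → s₀⁺` along the reals. -/
def HasGrowthPole (c : ℕ → ℂ) (μ s₀ : ℝ) : Prop :=
  0 < μ ∧ 0 < s₀ ∧ (∀ᶠ s : ℝ in 𝓝[>] s₀, LSeriesSummable c (s : ℂ)) ∧
    ∃ l : ℝ, 0 < l ∧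
      Tendsto (fun s : ℝ => |s - s₀| ^ μ * ∑' n : ℕ, ‖LSeries.term c (s : ℂ) n‖) (𝓝[>] s₀) (𝓝 l)

/-! Each of the four sums is rewritten as a combination of sums `∑ F(v)^{-s}` over integer points
`v` of a planar cone, with `F` one of the forms `x² + y²` and `xy`. The number of such points with
`F ≤ n` is asymptotic to `n` times the area of `{F ≤ 1}` in the cone, so each sum has a simple pole
at `1` with that area as residue (`CountingCone.dirPole`). Parity conditions multiply the residue by
a positive rational. Coprimality divides it by `∑ d^{-2s}` over odd `d`, which is finite and
positive at `s = 1` (`CountingCone.dirPole_coprime`). Only one-sided limits along the reals are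
needed, never a continuation.

Arithmetic of the lattices: two independent minimal vectors `v, w` of a well-rounded `Λ ⊆ ℤ²` form a
basis, and since `√3` is irrational the angle between them is never `π/3` or `2π/3`. Hence `±v, ±w`
are all the minimal vectors and the shortest basis is unique up to signs and order. With `N = ‖v‖²`
and `D = |det(v, w)|` one gets `sin θ = D / N`.

Weights: `sin θ` determines the similarity class, so the classes correspond to `𝒮`. The half-angle
parametrisation of Pythagorean triples writes `p/q = 2mn/(m² + n²)` with a unique coprime pair `0 <
n ≤ m < √3 n`. Either `p = 2mn`, `q = m² + n²` (opposite parity), or both are half of that (`m, n`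
odd). This gives two simple poles with positive residues.

Zeta functions: since `‖v‖ = ‖w‖`, the diagonals `v + w` and `v - w` are orthogonal, so `v + w =
a(m, n)` and `v - w = b(-n, m)` with `(m, n)` primitive. After normalising signs and quarter turns
the data are unique. The angle condition becomes `a < √3 b`, `b < √3 a`, while `det Λ = ab(m² +
n²)/2` and `|Λ|² = (a² + b²)(m² + n²)/4`. Both weights are products of a function of `(m, n)` and a
function of `(a, b)`. Once the integrality condition is split by parity, each series is a sum of two
products of sums with simple poles, hence has a double pole. -/

open MeasureTheory

/-! ### Calculus of poles of sums along the real axis -/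

/-- The sums `∑ N(x)^{-s}` converge for real `s > 1`, and `(s - 1)^μ ∑ N(x)^{-s}` tends to `l`
as `s → 1⁺`. -/
def DirPole {X : Type*} (N : X → ℝ) (μ : ℕ) (l : ℝ) : Prop :=
  (∀ s : ℝ, 1 < s → Summable fun x => N x ^ (-s)) ∧
    Tendsto (fun s : ℝ => (s - 1) ^ μ * ∑' x, N x ^ (-s)) (𝓝[>] 1) (𝓝 l)

namespace DirPole

variable {X Y : Type*} {N : X → ℝ} {M : Y → ℝ} {μ ν : ℕ} {l m : ℝ}

theorem congr_equiv (h : DirPole M μ l) (e : X ≃ Y) (he : ∀ x, N x = M (e x)) :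
    DirPole N μ l := by
  obtain rfl : N = fun x => M (e x) := funext he
  refine ⟨fun s hs => (e.summable_iff (f := fun y => M y ^ (-s))).2 (h.1 s hs), ?_⟩
  refine h.2.congr fun s => ?_
  rw [e.tsum_eq (fun y => M y ^ (-s))]

theorem of_bijective (h : DirPole N μ l) {f : X → Y} (hf : Function.Bijective f)
    (he : ∀ x, M (f x) = N x) : DirPole M μ l :=
  h.congr_equiv (Equiv.ofBijective f hf).symm fun y => by
    obtain ⟨x, rfl⟩ := hf.2 y
    rw [he, ← Equiv.ofBijective_apply f hf x, Equiv.symm_apply_apply]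

theorem comp_bijective (h : DirPole M μ l) {f : X → Y} (hf : Function.Bijective f)
    (he : ∀ x, N x = M (f x)) : DirPole N μ l :=
  h.congr_equiv (Equiv.ofBijective f hf) he

theorem const_mul (h : DirPole N μ l) (hN : ∀ x, 0 ≤ N x) {c : ℝ} (hc : 0 < c) :
    DirPole (fun x => c * N x) μ (c⁻¹ * l) := by
  have e : ∀ (s : ℝ) (x : X), (c * N x) ^ (-s) = c ^ (-s) * N x ^ (-s) := fun s x =>
    Real.mul_rpow hc.le (hN x)
  refine ⟨fun s hs => ?_, ?_⟩
  · simp only [e]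
    exact (h.1 s hs).mul_left _
  · have hc' : Tendsto (fun s : ℝ => c ^ (-s)) (𝓝[>] 1) (𝓝 c⁻¹) := by
      have : ContinuousAt (fun s : ℝ => c ^ (-s)) 1 :=
        ContinuousAt.rpow continuousAt_const continuousAt_neg (Or.inl hc.ne')
      have h2 := this.tendsto
      rw [Real.rpow_neg_one] at h2
      exact h2.mono_left nhdsWithin_le_nhds
    refine (hc'.mul h.2).congr fun s => ?_
    simp only [e, tsum_mul_left]
    ring

theorem sumElim (h : DirPole N μ l) (h' : DirPole M μ m) :
    DirPole (Sum.elim N M) μ (l + m) := by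
  have e : ∀ s : ℝ, 1 < s →
      HasSum (fun z => Sum.elim N M z ^ (-s)) (∑' x, N x ^ (-s) + ∑' y, M y ^ (-s)) := fun s hs =>
    HasSum.sum (f := fun z => Sum.elim N M z ^ (-s)) (h.1 s hs).hasSum (h'.1 s hs).hasSum
  refine ⟨fun s hs => (e s hs).summable, ?_⟩
  refine (h.2.add h'.2).congr' ?_
  filter_upwards [self_mem_nhdsWithin] with s hs
  rw [(e s hs).tsum_eq, mul_add]

/-- Residues subtract. The parity classes that are not lattices are reached in this way, as
complements of sublattices. -/
theorem compl (h : DirPole N μ l) (P : X → Prop) (h' : DirPole (fun x : {x // P x} => N x) μ m) :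
    DirPole (fun x : {x // ¬ P x} => N x) μ (l - m) := by
  refine ⟨fun s hs => (h.1 s hs).subtype _, ?_⟩
  refine (h.2.sub h'.2).congr' ?_
  filter_upwards [self_mem_nhdsWithin] with s hs
  have := (h.1 s hs).tsum_subtype_add_tsum_subtype_compl {x | P x}
  rw [← this, ← mul_sub]
  congr 1
  exact add_sub_cancel_left _ _

/-- The terms are nonnegative, so the double sum converges and factors; orders add. This is the
source of the double poles. -/
theorem mul (h : DirPole N μ l) (h' : DirPole M ν m) (hN : ∀ x, 0 ≤ N x) (hM : ∀ y, 0 ≤ M y) :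
    DirPole (fun z : X × Y => N z.1 * M z.2) (μ + ν) (l * m) := by
  have e : ∀ (s : ℝ) (z : X × Y), (N z.1 * M z.2) ^ (-s) = N z.1 ^ (-s) * M z.2 ^ (-s) :=
    fun s z => Real.mul_rpow (hN _) (hM _)
  have hs : ∀ s : ℝ, 1 < s → Summable fun z : X × Y => N z.1 ^ (-s) * M z.2 ^ (-s) :=
    fun s hs => (h.1 s hs).mul_of_nonneg (h'.1 s hs) (fun x => Real.rpow_nonneg (hN x) _)
      (fun x => Real.rpow_nonneg (hM x) _)
  refine ⟨fun s h1 => by simpa only [e] using hs s h1, ?_⟩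
  refine (h.2.mul h'.2).congr' ?_
  filter_upwards [self_mem_nhdsWithin] with s h1
  simp only [e]
  rw [← (h.1 s h1).tsum_mul_tsum (h'.1 s h1) (hs s h1)]
  ring

/-- Division of a product by a factor without a pole. -/
theorem of_mul (h : DirPole (fun z : X × Y => N z.1 * M z.2) μ l) (h' : DirPole N 0 m)
    (hm : m ≠ 0) (hN : ∀ x, 0 < N x) (hM : ∀ y, 0 ≤ M y) (hX : Nonempty X) :
    DirPole M μ (l / m) := by
  have e : ∀ (s : ℝ) (z : X × Y), (N z.1 * M z.2) ^ (-s) = N z.1 ^ (-s) * M z.2 ^ (-s) :=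
    fun s z => Real.mul_rpow (hN _).le (hM _)
  have hs : ∀ s : ℝ, 1 < s → Summable fun z : X × Y => N z.1 ^ (-s) * M z.2 ^ (-s) :=
    fun s hs => by simpa only [e] using h.1 s hs
  have hM' : ∀ s : ℝ, 1 < s → Summable fun y => M y ^ (-s) := fun s h1 => by
    obtain ⟨x⟩ := hX
    have := (hs s h1).comp_injective (Prod.mk_right_injective x)
    exact (summable_mul_left_iff (Real.rpow_pos_of_pos (hN x) _).ne').1 this
  refine ⟨hM', ?_⟩
  refine (h.2.div h'.2 hm).congr' ?_
  filter_upwards [self_mem_nhdsWithin] with s h1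
  have hpos : 0 < ∑' x, N x ^ (-s) := by
    obtain ⟨x⟩ := hX
    exact (h'.1 s h1).tsum_pos (fun x => Real.rpow_nonneg (hN x).le _) x
      (Real.rpow_pos_of_pos (hN x) _)
  simp only [e, Pi.div_apply]
  rw [← (h'.1 s h1).tsum_mul_tsum (hM' s h1) (hs s h1), pow_zero, one_mul]
  field_simp

end DirPole

/-- For `s > 1` the terms are dominated by those at `s = 1`, whose sum converges, so the sum tends
to its value there. This is the factor contributed by an odd common divisor `d`, as `F` is
homogeneous of degree two. -/
theorem dirPole_sq_odd : ∃ m : ℝ, 0 < m ∧ DirPole (fun d : {d : ℕ // Odd d} => (d : ℝ) ^ 2) 0 m := by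
  have hsum : Summable fun d : {d : ℕ // Odd d} => ((d : ℝ) ^ 2) ^ (-1 : ℝ) := by
    have : Summable fun d : ℕ => ((d : ℝ) ^ 2) ^ (-1 : ℝ) := by
      simp only [Real.rpow_neg_one]
      exact Real.summable_nat_pow_inv.2 (by norm_num)
    exact this.subtype _
  have hd : ∀ d : {d : ℕ // Odd d}, (1 : ℝ) ≤ (d : ℝ) ^ 2 := fun d =>
    one_le_pow₀ (by exact_mod_cast d.2.pos)
  have hb : ∀ s : ℝ, 1 < s → ∀ d : {d : ℕ // Odd d},
      ‖((d : ℝ) ^ 2) ^ (-s)‖ ≤ ((d : ℝ) ^ 2) ^ (-1 : ℝ) := fun s hs d => by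
    rw [Real.norm_of_nonneg (Real.rpow_nonneg (by positivity) _)]
    exact Real.rpow_le_rpow_of_exponent_le (hd d) (by linarith)
  refine ⟨∑' d : {d : ℕ // Odd d}, ((d : ℝ) ^ 2) ^ (-1 : ℝ), ?_, ?_, ?_⟩
  · exact hsum.tsum_pos (fun d => Real.rpow_nonneg (by positivity) _) ⟨1, odd_one⟩ (by norm_num)
  · exact fun s hs => Summable.of_norm_bounded hsum (hb s hs)
  · simp only [pow_zero, one_mul]
    refine tendsto_tsum_of_dominated_convergence hsum (fun d => ?_) ?_
    · have : ContinuousAt (fun s : ℝ => ((d : ℝ) ^ 2) ^ (-s)) 1 :=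
        ContinuousAt.rpow continuousAt_const continuousAt_neg
          (Or.inl (by linarith [hd d]))
      exact this.tendsto.mono_left nhdsWithin_le_nhds
    · filter_upwards [self_mem_nhdsWithin] with s hs
      exact hb s hs

/-! ### From sums over a set to Dirichlet series -/

section fibers

variable {X : Type*} {N : X → ℕ}

theorem hasSum_term_fiber (hf : ∀ n, Finite {x // N x = n}) (hN : ∀ x, 0 < N x) {s a : ℂ}
    (h : HasSum (fun x => (N x : ℂ) ^ (-s)) a) :
    HasSum (LSeries.term (fun n => (Nat.card {x // N x = n} : ℂ)) s) a := by
  have h2 := ((Equiv.sigmaFiberEquiv N).hasSum_iff.2 h)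
  refine h2.sigma fun n => ?_
  have : Fintype {x // N x = n} := Fintype.ofFinite _
  have h3 := hasSum_fintype (fun x : {x // N x = n} => (N (x : X) : ℂ) ^ (-s))
  have h4 : ∑ x : {x // N x = n}, (N (x : X) : ℂ) ^ (-s) =
      LSeries.term (fun n => (Nat.card {x // N x = n} : ℂ)) s n := by
    have h5 : ∀ x ∈ (Finset.univ : Finset {x // N x = n}),
        (N (x : X) : ℂ) ^ (-s) = (n : ℂ) ^ (-s) := fun x _ => by rw [x.2]
    rw [Finset.sum_congr rfl h5]
    -- `LSeries.term` is `0` at `n = 0` by convention; this agrees because `N` is positive and the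
    -- fibre is empty.
    rcases eq_or_ne n 0 with rfl | hn
    · have : IsEmpty {x // N x = 0} := ⟨fun x => (hN x).ne' x.2⟩
      simp
    · rw [LSeries.term_of_ne_zero hn, Complex.cpow_neg]
      simp [Nat.card_eq_fintype_card, div_eq_mul_inv]
  rw [h4] at h3
  exact h3

theorem ofReal_rpow_neg (x : X) (s : ℝ) :
    (((N x : ℝ) ^ (-s) : ℝ) : ℂ) = (N x : ℂ) ^ (-(s : ℂ)) := by
  rw [Complex.ofReal_cpow (Nat.cast_nonneg _)]
  simp

theorem norm_natCast_cpow_neg (hN : ∀ x, 0 < N x) (x : X) (s : ℂ) :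
    ‖(N x : ℂ) ^ (-s)‖ = (N x : ℝ) ^ (-s.re) := by
  rw [Complex.norm_natCast_cpow_of_pos (hN x)]
  simp

theorem summable_of_lseriesSummable (hf : ∀ n, Finite {x // N x = n}) (hN : ∀ x, 0 < N x) {s : ℝ}
    (h : LSeriesSummable (fun n => (Nat.card {x // N x = n} : ℂ)) s) :
    Summable fun x => (N x : ℝ) ^ (-s) := by
  rw [← (Equiv.sigmaFiberEquiv N).summable_iff]
  refine (summable_sigma_of_nonneg fun x => Real.rpow_nonneg (Nat.cast_nonneg _) _).2
    ⟨fun n => ?_, ?_⟩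
  · have := hf n
    exact Summable.of_finite
  · refine h.norm.congr fun n => ?_
    have : Fintype {x // N x = n} := Fintype.ofFinite _
    rw [tsum_fintype]
    have h5 : ∀ x ∈ (Finset.univ : Finset {x // N x = n}),
        ((fun x => (N x : ℝ) ^ (-s)) ∘ (Equiv.sigmaFiberEquiv N)) ⟨n, x⟩ =
          (n : ℝ) ^ (-s) := fun x _ => by
      simp [Equiv.sigmaFiberEquiv, x.2]
    refine Eq.trans ?_ (Finset.sum_congr rfl h5).symm
    rcases eq_or_ne n 0 with rfl | hn
    · have : IsEmpty {x // N x = 0} := ⟨fun x => (hN x).ne' x.2⟩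
      simp
    · rw [LSeries.norm_term_eq, if_neg hn]
      simp [Nat.card_eq_fintype_card, div_eq_mul_inv, Real.rpow_neg]

/-- A counting function asymptotic to `l n` gives a simple pole. -/
theorem dirPole_of_tendsto_card {l : ℝ} (hN : ∀ x, 0 < N x)
    (hf : ∀ n, Finite {x // N x ≤ n})
    (h : Tendsto (fun n : ℕ => (Nat.card {x // N x ≤ n} : ℝ) / n) atTop (𝓝 l)) :
    DirPole (fun x => (N x : ℝ)) 1 l := by
  have hf' : ∀ n, Finite {x // N x = n} := fun n =>
    Finite.of_injective (β := {x // N x ≤ n}) (fun x => ⟨x.1, x.2.le⟩) fun x y hxy => by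
      simpa [Subtype.ext_iff] using hxy
  have hcard : ∀ n : ℕ, ∑ k ∈ Finset.Icc 1 n, Nat.card {x // N x = k} =
      Nat.card {x // N x ≤ n} := fun n => by
    have hfin : {x | N x ≤ n}.Finite := hf n
    rw [Nat.subtype_card (p := fun x => N x ≤ n) hfin.toFinset (by simp),
      Finset.card_eq_sum_card_fiberwise (f := N) (t := Finset.Icc 1 n)
        (fun x hx => Finset.mem_coe.2 (Finset.mem_Icc.2 ⟨hN _, by simpa using hx⟩))]
    refine Finset.sum_congr rfl fun k hk => Nat.subtype_card _ fun x => ?_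
    simp only [Finset.mem_filter, Set.Finite.mem_toFinset, Set.mem_ofPred_eq, and_iff_right_iff_imp]
    rintro rfl
    exact (Finset.mem_Icc.1 hk).2
  set f : ℕ → ℝ := fun n => (Nat.card {x // N x = n} : ℝ) with hfdef
  have h1 : Tendsto (fun n : ℕ => (∑ k ∈ Finset.Icc 1 n, f k) / (n : ℝ)) atTop (𝓝 l) := by
    refine h.congr fun n => ?_
    rw [← hcard n]
    push_cast
    rfl
  -- Abelian theorem: if the averages of the coefficients tend to `l`, then `(s - 1) L(s) → l`.
  have h2 := LSeries_tendsto_sub_mul_nhds_one_of_tendsto_sum_div_and_nonneg f h1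
    fun n => Nat.cast_nonneg _
  have hS : ∀ s : ℝ, 1 < s →
      LSeriesSummable (fun n => (Nat.card {x // N x = n} : ℂ)) s := fun s hs => by
    have := LSeriesSummable_of_sum_norm_bigO_and_nonneg (f := f) (r := 1) (s := s)
      (Asymptotics.isBigO_atTop_natCast_rpow_of_tendsto_div_rpow (a := l) (by simpa using h1))
      (fun n => Nat.cast_nonneg _) zero_le_one (by simpa using hs)
    simpa [hfdef] using this
  have hX : ∀ s : ℝ, 1 < s → Summable fun x => (N x : ℝ) ^ (-s) := fun s hs =>
    summable_of_lseriesSummable hf' hN (hS s hs)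
  refine ⟨hX, ?_⟩
  have h3 : Tendsto (fun s : ℝ => (((s - 1) ^ 1 * ∑' x, (N x : ℝ) ^ (-s) : ℝ) : ℂ)) (𝓝[>] 1)
      (𝓝 (l : ℂ)) := by
    refine h2.congr' ?_
    filter_upwards [self_mem_nhdsWithin] with s hs
    have h4 : HasSum (fun x => (N x : ℂ) ^ (-(s : ℂ))) ((∑' x, (N x : ℝ) ^ (-s) : ℝ) : ℂ) := by
      simpa only [ofReal_rpow_neg] using Complex.hasSum_ofReal.2 (hX s hs).hasSum
    have h5 := (hasSum_term_fiber hf' hN h4).tsum_eq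
    have h6 : LSeries (fun n => (f n : ℂ)) s = ((∑' x, (N x : ℝ) ^ (-s) : ℝ) : ℂ) := by
      rw [← h5]
      simp [LSeries, hfdef]
    rw [h6]
    push_cast
    ring
  exact tendsto_ofReal_iff.1 h3

end fibers

/-- A pole of the sum `∑ N(x)^{-s}` at `1` with natural numbers `N(x)`, in the sense of the
associated Dirichlet series. -/
theorem DirPole.hasGrowthPole {X : Type*} {N : X → ℝ} {μ : ℕ} {l : ℝ} (h : DirPole N μ l)
    (hl : 0 < l) (hμ : 0 < μ) (hN : ∀ x, ∃ n : ℕ, 0 < n ∧ N x = n) :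
    ConvergesRightOf N 1 ∧ AnalyticOnNhd ℂ (normSeries N) {s : ℂ | 1 < s.re} ∧
      HasGrowthPole (normCoeff N) μ 1 := by
  choose M hM hNM using hN
  obtain rfl : N = fun x => (M x : ℝ) := funext hNM
  have hc : normCoeff (fun x => (M x : ℝ)) = fun n => (Nat.card {x // M x = n} : ℂ) := by
    funext n
    simp [normCoeff]
  have ht : ∀ s, normTerm (fun x => (M x : ℝ)) s = fun x => (M x : ℂ) ^ (-s) := fun s => by
    funext x
    simp [normTerm]
  have hfin : ∀ n, Finite {x // M x = n} := fun n => by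
    have h2 := (h.1 2 one_lt_two).subtype {x | M x = n}
    rcases isEmpty_or_nonempty {x // M x = n} with h0 | ⟨⟨x0, hx0⟩⟩
    · infer_instance
    · have hn : 0 < n := hx0 ▸ hM x0
      -- On a fibre the terms are constant and positive; summability at exponent `2` then forces the
      -- fibre to be finite.
      have h3 : Summable fun _ : {x // M x = n} => (n : ℝ) ^ (-2 : ℝ) :=
        h2.congr fun x => by
          have : M x.1 = n := x.2
          simp [this]
      by_contra hinf
      rw [not_finite_iff_infinite] at hinf
      exact (Real.rpow_pos_of_pos (Nat.cast_pos.2 hn) (-2 : ℝ)).ne' ((summable_const_iff _).1 h3)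
  have hsum : ∀ s : ℂ, 1 < s.re → Summable fun x => (M x : ℂ) ^ (-s) := fun s hs => by
    refine Summable.of_norm ?_
    simp only [norm_natCast_cpow_neg hM]
    exact h.1 _ hs
  have hL : ∀ s : ℂ, 1 < s.re → LSeriesHasSum (normCoeff fun x => (M x : ℝ)) s
      (normSeries (fun x => (M x : ℝ)) s) := fun s hs => by
    rw [normSeries, hc, ht]
    exact hasSum_term_fiber hfin hM (hsum s hs).hasSum
  refine ⟨⟨fun n => ?_, fun s hs => ⟨?_, hL s hs⟩⟩, ?_, ?_⟩
  · simpa using hfin n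
  · rw [ht]
    exact hsum s hs
  · have h1 : LSeries.abscissaOfAbsConv (normCoeff fun x => (M x : ℝ)) ≤ 1 := by
      have := LSeries.abscissaOfAbsConv_le_of_forall_lt_LSeriesSummable
        (f := normCoeff fun x => (M x : ℝ)) (x := 1) fun y hy =>
          (hL y (by simpa using hy)).LSeriesSummable
      simpa using this
    have ha : AnalyticOnNhd ℂ (LSeries (normCoeff fun x => (M x : ℝ))) {s : ℂ | 1 < s.re} :=
      (LSeries_analyticOnNhd _).mono fun s hs => lt_of_le_of_lt h1 (by exact_mod_cast hs)
    refine ha.congr (isOpen_lt continuous_const Complex.continuous_re) fun s hs => ?_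
    exact (hL s hs).LSeries_eq
  · refine ⟨by exact_mod_cast hμ, one_pos, ?_, l, hl, ?_⟩
    · filter_upwards [self_mem_nhdsWithin] with s hs
      exact (hL s (by simpa using hs)).LSeriesSummable
    · refine h.2.congr' ?_
      filter_upwards [self_mem_nhdsWithin] with s hs
      have hs' : (1 : ℝ) < s := hs
      rw [abs_of_pos (sub_pos.2 hs'), Real.rpow_natCast]
      congr 1
      have h4 : HasSum (fun x => (M x : ℂ) ^ (-(s : ℂ))) ((∑' x, (M x : ℝ) ^ (-s) : ℝ) : ℂ) := by
        simpa only [ofReal_rpow_neg] using Complex.hasSum_ofReal.2 (h.1 s hs).hasSum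
      have h5 := hasSum_term_fiber hfin hM h4
      rw [← hc] at h5
      -- At real `s` every term is a nonnegative real, so passing to norms does not change the sum.
      have h6 : ∀ n, LSeries.term (normCoeff fun x => (M x : ℝ)) s n =
          ((‖LSeries.term (normCoeff fun x => (M x : ℝ)) (s : ℂ) n‖ : ℝ) : ℂ) := fun n => by
        rcases eq_or_ne n 0 with rfl | hn
        · simp
        · rw [LSeries.norm_term_eq, if_neg hn, LSeries.term_of_ne_zero hn, hc]
          simp only [Complex.norm_natCast, Complex.ofReal_re, Complex.ofReal_div]
          rw [Complex.ofReal_cpow (Nat.cast_nonneg _)]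
          simp
      have h7 : HasSum (fun n => ((‖LSeries.term (normCoeff fun x => (M x : ℝ)) (s : ℂ) n‖ : ℝ) : ℂ))
          ((∑' x, (M x : ℝ) ^ (-s) : ℝ) : ℂ) := by
        refine h5.congr_fun ?_ 
        exact fun n => (h6 n).symm
      exact (Complex.hasSum_ofReal.1 h7).tsum_eq.symm

/-! ### Lattice points in planar cones -/

/-- An integer vector as a point of the plane. -/
def intPoint (v : ℤ × ℤ) : Fin 2 → ℝ := ![(v.1 : ℝ), (v.2 : ℝ)]

/-- A cone `X` in the plane with a quadratic form `F`, integral at integer points, such that the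
lattice points `x ∈ X` with `F x ≤ c` can be counted. -/
structure CountingCone (X : Set (Fin 2 → ℝ)) (F : (Fin 2 → ℝ) → ℝ) : Prop where
  smul_mem : ∀ ⦃x⦄ ⦃r : ℝ⦄, x ∈ X → 0 < r → r • x ∈ X
  map_smul : ∀ x ⦃r : ℝ⦄, 0 ≤ r → F (r • x) = r ^ 2 * F x
  bound : ∃ C : ℝ, 0 ≤ C ∧ ∀ x ∈ X, ‖x‖ ^ 2 ≤ C * F x
  measurableSet : MeasurableSet {x ∈ X | F x ≤ 1}
  frontier : volume (frontier {x ∈ X | F x ≤ 1}) = 0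
  pos : 0 < volume.real {x ∈ X | F x ≤ 1}
  integral : ∀ v : ℤ × ℤ, intPoint v ∈ X → ∃ n : ℕ, 0 < n ∧ F (intPoint v) = n

theorem intPoint_injective : Function.Injective intPoint := fun v w h => by
  have h0 := congrFun h 0
  have h1 := congrFun h 1
  simp only [intPoint, Matrix.cons_val_zero, Matrix.cons_val_one, Int.cast_inj] at h0 h1
  exact Prod.ext h0 h1

theorem mem_span_basisFun_iff (x : Fin 2 → ℝ) :
    x ∈ Submodule.span ℤ (Set.range (Pi.basisFun ℝ (Fin 2))) ↔ ∃ v, intPoint v = x := by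
  rw [Module.Basis.mem_span_iff_repr_mem]
  simp only [Pi.basisFun_repr, Fin.forall_fin_two]
  constructor
  · rintro ⟨⟨m, hm⟩, n, hn⟩
    refine ⟨(m, n), ?_⟩
    ext i
    fin_cases i
    · simpa [intPoint] using hm
    · simpa [intPoint] using hn
  · rintro ⟨v, rfl⟩
    exact ⟨⟨v.1, by simp [intPoint]⟩, v.2, by simp [intPoint]⟩

theorem covolume_span_basisFun :
    ZLattice.covolume (Submodule.span ℤ (Set.range (Pi.basisFun ℝ (Fin 2)))) = 1 := by
  rw [ZLattice.covolume_eq_measure_fundamentalDomain _ _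
    (ZSpan.isAddFundamentalDomain (Pi.basisFun ℝ (Fin 2)) volume),
    ZSpan.fundamentalDomain_pi_basisFun]
  simp [Measure.real, Real.volume_pi_Ico]

namespace CountingCone

variable {X : Set (Fin 2 → ℝ)} {F : (Fin 2 → ℝ) → ℝ}

theorem finite (h : CountingCone X F) (c : ℝ) :
    Finite {v : ℤ × ℤ // intPoint v ∈ X ∧ F (intPoint v) ≤ c} := by
  obtain ⟨C, hC, hb⟩ := h.bound
  have : {v : ℤ × ℤ | intPoint v ∈ X ∧ F (intPoint v) ≤ c} ⊆
      Set.Icc (-⌈C * c + 1⌉) ⌈C * c + 1⌉ ×ˢ Set.Icc (-⌈C * c + 1⌉) ⌈C * c + 1⌉ := by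
    rintro v ⟨hv, hc⟩
    -- From `t² ≤ C c` follows `t ≤ t² + 1 ≤ C c + 1`, which avoids square roots.
    have key : ∀ i, |intPoint v i| ≤ C * c + 1 := fun i => by
      have h1 : ‖intPoint v i‖ ≤ ‖intPoint v‖ := norm_le_pi_norm _ i
      rw [Real.norm_eq_abs] at h1
      have h2 := hb _ hv
      have h3 := mul_le_mul_of_nonneg_left hc hC
      nlinarith [sq_nonneg (‖intPoint v‖ - 1), norm_nonneg (intPoint v)]
    have h0 := abs_le.1 (key 0)
    have h1 := abs_le.1 (key 1)
    simp only [intPoint, Matrix.cons_val_zero, Matrix.cons_val_one] at h0 h1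
    have hle := Int.le_ceil (C * c + 1)
    refine ⟨⟨?_, ?_⟩, ?_, ?_⟩ <;> refine (Int.cast_le (R := ℝ)).1 ?_ <;> push_cast <;> linarith
  exact (((Set.finite_Icc _ _).prod (Set.finite_Icc _ _)).subset this).to_subtype

/-- By homogeneity, the points with `F ≤ c` are the lattice points of the region `{F ≤ 1}` dilated
by `√c`. Their number is asymptotic to `c` times its area, as `ℤ²` has covolume `1`. -/
theorem dirPole (h : CountingCone X F) :
    DirPole (fun v : {v // intPoint v ∈ X} => F (intPoint v)) 1
      (volume.real {x ∈ X | F x ≤ 1}) := by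
  choose N hN hFN using h.integral
  have hb : Bornology.IsBounded {x ∈ X | F x ≤ 1} := by
    obtain ⟨C, hC, hb⟩ := h.bound
    refine isBounded_iff_forall_norm_le.2 ⟨C + 1, fun x hx => ?_⟩
    have h1 := hb x hx.1
    have h2 := mul_le_mul_of_nonneg_left hx.2 hC
    nlinarith [sq_nonneg (‖x‖ - 1), norm_nonneg x]
  have hlim := ZLattice.covolume.tendsto_card_le_div
    (Submodule.span ℤ (Set.range (Pi.basisFun ℝ (Fin 2)))) h.smul_mem (F := F)
    (by simpa using h.map_smul) hb h.measurableSet h.frontier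
  rw [covolume_span_basisFun, div_one] at hlim
  have e : ∀ c : ℝ, Nat.card ({x ∈ X | F x ≤ c} ∩
      Submodule.span ℤ (Set.range (Pi.basisFun ℝ (Fin 2))) : Set (Fin 2 → ℝ)) =
        Nat.card {v : ℤ × ℤ // intPoint v ∈ X ∧ F (intPoint v) ≤ c} := fun c => by
    refine (Nat.card_congr (Equiv.ofBijective
      (fun v => ⟨intPoint v.1, v.2, (mem_span_basisFun_iff _).2 ⟨v.1, rfl⟩⟩) ⟨?_, ?_⟩)).symm
    · intro v w hvw
      exact Subtype.ext (intPoint_injective (Subtype.ext_iff.1 hvw))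
    · rintro ⟨x, hx, hx'⟩
      obtain ⟨v, rfl⟩ := (mem_span_basisFun_iff _).1 hx'
      exact ⟨⟨v, hx⟩, rfl⟩
  simp only [e] at hlim
  have e2 : ∀ n : ℕ, {v : ℤ × ℤ // intPoint v ∈ X ∧ F (intPoint v) ≤ n} ≃
      {v : {v // intPoint v ∈ X} // N v.1 v.2 ≤ n} := fun n =>
    { toFun := fun v => ⟨⟨v.1, v.2.1⟩, by
        have := v.2.2
        rw [hFN _ v.2.1] at this
        exact_mod_cast this⟩
      invFun := fun v => ⟨v.1.1, v.1.2, by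
        rw [hFN _ v.1.2]
        exact_mod_cast v.2⟩
      left_inv := fun v => rfl
      right_inv := fun v => rfl }
  have key := dirPole_of_tendsto_card (X := {v // intPoint v ∈ X}) (N := fun v => N v.1 v.2)
    (l := volume.real {x ∈ X | F x ≤ 1}) (fun v => hN _ _)
    (fun n => by
      have := h.finite n
      exact Finite.of_equiv _ (e2 n))
    (by
      refine (hlim.comp tendsto_natCast_atTop_atTop).congr fun n => ?_
      simp only [Function.comp]
      rw [Nat.card_congr (e2 n)])
  exact key.congr_equiv (Equiv.refl _) fun v => hFN _ v.2

end CountingCone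

/-! ### Parity classes and primitive points -/

/-- The linear map `(x, y) ↦ (x + y, x - y)` of the plane. -/
noncomputable def sumDiff : (Fin 2 → ℝ) →ₗ[ℝ] (Fin 2 → ℝ) :=
  Matrix.toLin' !![1, 1; 1, -1]

theorem sumDiff_apply (x : Fin 2 → ℝ) : sumDiff x = ![x 0 + x 1, x 0 - x 1] := by
  ext i
  fin_cases i <;> simp [sumDiff, Matrix.mulVec, dotProduct, Fin.sum_univ_two, sub_eq_add_neg]

theorem sumDiff_intPoint (v : ℤ × ℤ) : sumDiff (intPoint v) = intPoint (v.1 + v.2, v.1 - v.2) := by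
  rw [sumDiff_apply]
  simp [intPoint]

theorem det_sumDiff : LinearMap.det sumDiff = -2 := by
  rw [sumDiff, LinearMap.det_toLin']
  norm_num [Matrix.det_fin_two]

/-- `sumDiff` maps `ℤ²` onto the points of even coordinate sum. Pulling the cone and the form back
turns counting in that sublattice into counting in `ℤ²`, and the area is divided by `|det| = 2`. -/
theorem CountingCone.comp_sumDiff {X : Set (Fin 2 → ℝ)} {F : (Fin 2 → ℝ) → ℝ}
    (h : CountingCone X F) : CountingCone (sumDiff ⁻¹' X) (F ∘ sumDiff) ∧
      volume.real {x ∈ sumDiff ⁻¹' X | (F ∘ sumDiff) x ≤ 1} =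
        volume.real {x ∈ X | F x ≤ 1} / 2 := by
  have hd : LinearMap.det sumDiff ≠ 0 := by
    rw [det_sumDiff]
    norm_num
  have hA : {x ∈ sumDiff ⁻¹' X | (F ∘ sumDiff) x ≤ 1} = sumDiff ⁻¹' {x ∈ X | F x ≤ 1} := rfl
  have hcont : Continuous sumDiff := LinearMap.continuous_of_finiteDimensional _
  have hvol : volume.real {x ∈ sumDiff ⁻¹' X | (F ∘ sumDiff) x ≤ 1} =
        volume.real {x ∈ X | F x ≤ 1} / 2 := by
    rw [hA, Measure.real, Measure.addHaar_preimage_linearMap _ hd, det_sumDiff, ENNReal.toReal_mul,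
      Measure.real]
    rw [ENNReal.toReal_ofReal (abs_nonneg _)]
    norm_num
    ring
  refine ⟨⟨fun x r hx hr => ?_, fun x r hr => ?_, ?_, ?_, ?_, ?_, fun v hv => ?_⟩, hvol⟩
  · rw [Set.mem_preimage, LinearMap.map_smul]
    exact h.smul_mem hx hr
  · simp only [Function.comp, LinearMap.map_smul]
    exact h.map_smul _ hr
  · obtain ⟨C, hC, hb⟩ := h.bound
    refine ⟨C, hC, fun x hx => le_trans ?_ (hb _ hx)⟩
    refine pow_le_pow_left₀ (norm_nonneg _) ((pi_norm_le_iff_of_nonneg (norm_nonneg _)).2 ?_) 2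
    have h0 := abs_le.1 (norm_le_pi_norm (sumDiff x) 0)
    have h1 := abs_le.1 (norm_le_pi_norm (sumDiff x) 1)
    generalize ‖sumDiff x‖ = t at h0 h1
    simp only [sumDiff_apply, Matrix.cons_val_zero, Matrix.cons_val_one] at h0 h1
    rw [Fin.forall_fin_two]
    constructor <;> rw [Real.norm_eq_abs, abs_le] <;> constructor <;> linarith
  · rw [hA]
    exact hcont.measurable h.measurableSet
  · rw [hA]
    -- An invertible linear map is a homeomorphism, so preimage and frontier commute.
    let e := (LinearEquiv.ofIsUnitDet (f := sumDiff) (v := Pi.basisFun ℝ (Fin 2))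
      (v' := Pi.basisFun ℝ (Fin 2)) (by
        rw [LinearMap.det_toMatrix]; exact hd.isUnit)).toContinuousLinearEquiv.toHomeomorph
    have he : (e : (Fin 2 → ℝ) → (Fin 2 → ℝ)) = sumDiff := rfl
    rw [← he, ← e.preimage_frontier, he, Measure.addHaar_preimage_linearMap _ hd, h.frontier,
      mul_zero]
  · rw [hvol]
    exact half_pos h.pos
  · rw [Set.mem_preimage, sumDiff_intPoint] at hv
    simp only [Function.comp, sumDiff_intPoint]
    exact h.integral _ hv

theorem DirPole.subtype_diff {X : Type*} {N : X → ℝ} {μ : ℕ} {l m : ℝ} {A B C : X → Prop}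
    (hA : DirPole (fun x : {x // A x} => N x) μ l) (hB : DirPole (fun x : {x // B x} => N x) μ m)
    (hBA : ∀ x, B x → A x) (hC : ∀ x, C x ↔ A x ∧ ¬ B x) :
    DirPole (fun x : {x // C x} => N x) μ (l - m) := by
  have hB' : DirPole (fun x : {x : {x // A x} // B x} => N x) μ m :=
    hB.congr_equiv (Equiv.subtypeSubtypeEquivSubtype fun {x} => hBA x) fun x => rfl
  refine (hA.compl (fun x => B x) hB').congr_equiv
    { toFun := fun x => ⟨⟨x.1, ((hC _).1 x.2).1⟩, ((hC _).1 x.2).2⟩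
      invFun := fun x => ⟨x.1.1, (hC _).2 ⟨x.1.2, x.2⟩⟩
      left_inv := fun x => rfl
      right_inv := fun x => rfl } fun x => rfl

namespace CountingCone

variable {X : Set (Fin 2 → ℝ)} {F : (Fin 2 → ℝ) → ℝ}

theorem dirPole_even_add (h : CountingCone X F) :
    DirPole (fun v : {v : ℤ × ℤ // intPoint v ∈ X ∧ Even (v.1 + v.2)} => F (intPoint v)) 1
      (volume.real {x ∈ X | F x ≤ 1} / 2) := by
  have h2 := h.comp_sumDiff.1.dirPole
  rw [h.comp_sumDiff.2] at h2
  refine h2.of_bijective (f := fun v : {v // intPoint v ∈ sumDiff ⁻¹' X} =>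
    (⟨(v.1.1 + v.1.2, v.1.1 - v.1.2), by
      have := v.2
      rwa [Set.mem_preimage, sumDiff_intPoint] at this, ⟨v.1.1, by ring⟩⟩ :
        {v : ℤ × ℤ // intPoint v ∈ X ∧ Even (v.1 + v.2)})) ⟨?_, ?_⟩ ?_
  · rintro ⟨⟨a, b⟩, _⟩ ⟨⟨c, d⟩, _⟩ h
    simp only [Subtype.mk.injEq, Prod.mk.injEq] at h ⊢
    omega
  · rintro ⟨⟨a, b⟩, hv, k, hk⟩
    simp only at hk
    have hab : (k + (a - k), k - (a - k)) = (a, b) := by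
      exact Prod.ext (by simp only; omega) (by simp only; omega)
    refine ⟨⟨(k, a - k), ?_⟩, ?_⟩
    · rw [Set.mem_preimage, sumDiff_intPoint]
      simpa only [hab] using hv
    · exact Subtype.ext hab
  · intro v
    simp [sumDiff_intPoint]

/-- Doubling maps the integer points of the cone onto these and multiplies `F` by `4`. -/
theorem dirPole_even_even (h : CountingCone X F) :
    DirPole (fun v : {v : ℤ × ℤ // intPoint v ∈ X ∧ Even v.1 ∧ Even v.2} => F (intPoint v)) 1
      (volume.real {x ∈ X | F x ≤ 1} / 4) := by
  have hpos : ∀ v : {v // intPoint v ∈ X}, 0 ≤ F (intPoint v) := fun v => by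
    obtain ⟨n, _, hn⟩ := h.integral v.1 v.2
    rw [hn]
    exact Nat.cast_nonneg _
  have h2 := h.dirPole.const_mul hpos (c := 4) (by norm_num)
  rw [← div_eq_inv_mul] at h2
  have e : ∀ v : ℤ × ℤ, intPoint (2 * v.1, 2 * v.2) = (2 : ℝ) • intPoint v := fun v => by
    ext i
    fin_cases i <;> simp [intPoint]
  refine h2.of_bijective (f := fun v : {v // intPoint v ∈ X} =>
    (⟨(2 * v.1.1, 2 * v.1.2), by
      rw [e]
      exact h.smul_mem v.2 two_pos, even_two_mul _, even_two_mul _⟩ :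
        {v : ℤ × ℤ // intPoint v ∈ X ∧ Even v.1 ∧ Even v.2})) ⟨?_, ?_⟩ ?_
  · rintro ⟨⟨a, b⟩, _⟩ ⟨⟨c, d⟩, _⟩ h
    simp only [Subtype.mk.injEq, Prod.mk.injEq] at h ⊢
    omega
  · rintro ⟨⟨a, b⟩, hv, ⟨k, hk⟩, m, hm⟩
    simp only at hk hm
    obtain rfl : a = 2 * k := by omega
    obtain rfl : b = 2 * m := by omega
    refine ⟨⟨(k, m), ?_⟩, rfl⟩
    have := h.smul_mem hv (r := 2⁻¹) (by norm_num)
    rwa [e (k, m), smul_smul, inv_mul_cancel₀ two_ne_zero, one_smul] at this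
  · intro v
    simp only [e]
    rw [h.map_smul _ zero_le_two]
    norm_num

theorem dirPole_odd_add (h : CountingCone X F) :
    DirPole (fun v : {v : ℤ × ℤ // intPoint v ∈ X ∧ Odd (v.1 + v.2)} => F (intPoint v)) 1
      (volume.real {x ∈ X | F x ≤ 1} / 2) := by
  have := h.dirPole.subtype_diff (N := fun v => F (intPoint v)) h.dirPole_even_add
    (C := fun v => intPoint v ∈ X ∧ Odd (v.1 + v.2)) (fun v hv => hv.1)
    (fun v => by rw [← Int.not_even_iff_odd]; tauto)
  convert this using 1
  ring

/-- If the sum of the coordinates is even, they are both even or both odd, whence `1/2 - 1/4`. -/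
theorem dirPole_odd_odd (h : CountingCone X F) :
    DirPole (fun v : {v : ℤ × ℤ // intPoint v ∈ X ∧ Odd v.1 ∧ Odd v.2} => F (intPoint v)) 1
      (volume.real {x ∈ X | F x ≤ 1} / 4) := by
  have := h.dirPole_even_add.subtype_diff (N := fun v => F (intPoint v)) h.dirPole_even_even
    (C := fun v => intPoint v ∈ X ∧ Odd v.1 ∧ Odd v.2)
    (fun v hv => ⟨hv.1, hv.2.1.add hv.2.2⟩)
    (fun v => by
      rw [← Int.not_even_iff_odd, ← Int.not_even_iff_odd, Int.even_add]; tauto)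
  convert this using 1
  ring

/-- Passage from lattice points to primitive lattice points. -/
theorem dirPole_coprime (h : CountingCone X F) {P : ℤ × ℤ → Prop} {l : ℝ} (hl : 0 < l)
    (hP : ∀ v : ℤ × ℤ, P v → ¬ (Even v.1 ∧ Even v.2))
    (hd : ∀ (d : ℕ) (v : ℤ × ℤ), Odd d → (P (d * v.1, d * v.2) ↔ P v))
    (hF : DirPole (fun v : {v : ℤ × ℤ // intPoint v ∈ X ∧ P v} => F (intPoint v)) 1 l) :
    ∃ m : ℝ, 0 < m ∧ DirPole (fun v : {v : ℤ × ℤ // intPoint v ∈ X ∧ P v ∧ Int.gcd v.1 v.2 = 1} =>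
      F (intPoint v)) 1 m := by
  obtain ⟨z, hz, hz'⟩ := dirPole_sq_odd
  have e : ∀ (d : ℕ) (v : ℤ × ℤ), intPoint (d * v.1, d * v.2) = (d : ℝ) • intPoint v :=
    fun d v => by
      ext i
      fin_cases i <;> simp [intPoint]
  refine ⟨l / z, div_pos hl hz, DirPole.of_mul (N := fun d : {d : ℕ // Odd d} => (d : ℝ) ^ 2)
    ?_ hz' hz.ne' (fun d => ?_) (fun v => ?_) ⟨⟨1, odd_one⟩⟩⟩
  -- Every point satisfying `P` is uniquely `d v'` with `v'` primitive and `d` its gcd; `d` is odd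
  -- because `P` excludes two even coordinates. As `F(d v') = d² F(v')`, the sum factors.
  · refine hF.comp_bijective (f := fun z : {d : ℕ // Odd d} ×
      {v : ℤ × ℤ // intPoint v ∈ X ∧ P v ∧ Int.gcd v.1 v.2 = 1} =>
        (⟨(z.1.1 * z.2.1.1, z.1.1 * z.2.1.2), by
          rw [e]
          exact h.smul_mem z.2.2.1 (by exact_mod_cast z.1.2.pos), (hd _ _ z.1.2).2 z.2.2.2.1⟩ :
          {v : ℤ × ℤ // intPoint v ∈ X ∧ P v})) ⟨?_, ?_⟩ ?_
    · rintro ⟨⟨d, hd1⟩, ⟨a, b⟩, ha, hP1, hg⟩ ⟨⟨d', hd1'⟩, ⟨a', b'⟩, ha', hP1', hg'⟩ heq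
      simp only [Subtype.mk.injEq, Prod.mk.injEq] at heq hg hg' ⊢
      have h1 : Int.gcd (d * a) (d * b) = d := by rw [Int.gcd_mul_left, hg]; simp
      have h2 : Int.gcd (d' * a') (d' * b') = d' := by rw [Int.gcd_mul_left, hg']; simp
      have h3 : d = d' := by rw [← h1, ← h2, heq.1, heq.2]
      subst h3
      have h4 : (d : ℤ) ≠ 0 := by exact_mod_cast hd1.pos.ne'
      exact ⟨rfl, mul_left_cancel₀ h4 heq.1, mul_left_cancel₀ h4 heq.2⟩
    · rintro ⟨⟨a, b⟩, ha, hPv⟩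
      have hne := hP _ hPv
      simp only at hne
      have hg : 0 < Int.gcd a b := by
        rw [Int.gcd_pos_iff]
        by_contra! hab
        rw [hab.1, hab.2] at hne
        simp at hne
      obtain ⟨a', b', hg1, ha', hb'⟩ := Int.exists_gcd_one hg
      have hodd : Odd (Int.gcd a b) := by
        rw [← Nat.not_even_iff_odd]
        rintro hev
        have : (2 : ℤ) ∣ Int.gcd a b := by exact_mod_cast hev.two_dvd
        exact hne ⟨even_iff_two_dvd.2 (this.trans (Int.gcd_dvd_left ..)),
          even_iff_two_dvd.2 (this.trans (Int.gcd_dvd_right ..))⟩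
      have hab : ((Int.gcd a b : ℤ) * a', (Int.gcd a b : ℤ) * b') = (a, b) := by
        rw [mul_comm, ← ha', mul_comm, ← hb']
      refine ⟨⟨⟨Int.gcd a b, hodd⟩, ⟨(a', b'), ?_, ?_, hg1⟩⟩, ?_⟩
      · have h1 := e (Int.gcd a b) (a', b')
        simp only at h1
        rw [hab] at h1
        have h2 := h.smul_mem ha (r := (Int.gcd a b : ℝ)⁻¹) (by positivity)
        rw [h1, smul_smul, inv_mul_cancel₀ (by positivity), one_smul] at h2
        exact h2
      · rw [← hd _ _ hodd]
        simpa only [hab] using hPv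
      · exact Subtype.ext hab
    · rintro ⟨⟨d, hd1⟩, v, hv⟩
      simp only [e]
      rw [h.map_smul _ (Nat.cast_nonneg _)]
  · have := d.2.pos
    positivity
  · obtain ⟨n, _, hn⟩ := h.integral v.1 v.2.1
    rw [hn]
    exact Nat.cast_nonneg _

theorem dirPole_coprime_odd_add (h : CountingCone X F) :
    ∃ m : ℝ, 0 < m ∧ DirPole (fun v : {v : ℤ × ℤ // intPoint v ∈ X ∧ Odd (v.1 + v.2) ∧
      Int.gcd v.1 v.2 = 1} => F (intPoint v)) 1 m := by
  refine h.dirPole_coprime (half_pos h.pos) (fun v hv hv' => ?_) (fun d v hd => ?_)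
    h.dirPole_odd_add
  · exact Int.not_even_iff_odd.2 hv (hv'.1.add hv'.2)
  · have : Odd (d : ℤ) := by exact_mod_cast hd
    simp only [← mul_add, Int.odd_mul, this, true_and]

theorem dirPole_coprime_odd_odd (h : CountingCone X F) :
    ∃ m : ℝ, 0 < m ∧ DirPole (fun v : {v : ℤ × ℤ // intPoint v ∈ X ∧ (Odd v.1 ∧ Odd v.2) ∧
      Int.gcd v.1 v.2 = 1} => F (intPoint v)) 1 m := by
  have hpos := h.pos
  refine h.dirPole_coprime (l := volume.real {x ∈ X | F x ≤ 1} / 4) (by positivity)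
    (fun v hv hv' => ?_) (fun d v hd => ?_) h.dirPole_odd_odd
  · exact Int.not_even_iff_odd.2 hv.1 hv'.1
  · have : Odd (d : ℤ) := by exact_mod_cast hd
    simp only [Int.odd_mul, this, true_and]

end CountingCone

/-! ### The cones and forms that occur -/

/-- A small triangle in the plane. -/
def smallTriangle : Set (Fin 2 → ℝ) := {x | 0 < x 1 ∧ x 1 < x 0 ∧ 2 * x 0 < 3 * x 1 ∧ 2 * x 0 < 1}

theorem isOpen_smallTriangle : IsOpen smallTriangle := by
  have h0 : Continuous fun x : Fin 2 → ℝ => x 0 := continuous_apply 0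
  have h1 : Continuous fun x : Fin 2 → ℝ => x 1 := continuous_apply 1
  exact (isOpen_lt continuous_const h1).inter ((isOpen_lt h1 h0).inter
    ((isOpen_lt (h0.const_mul 2) (h1.const_mul 3)).inter
      (isOpen_lt (h0.const_mul 2) continuous_const)))

/-- The triangle is open, nonempty and contained in every truncated cone used below, so it certifies
that all their areas are positive. -/
theorem volume_real_pos {A : Set (Fin 2 → ℝ)} (hA : Bornology.IsBounded A)
    (h : smallTriangle ⊆ A) : 0 < volume.real A := by
  have h1 : 0 < volume smallTriangle :=
    isOpen_smallTriangle.measure_pos _ ⟨![2 / 5, 3 / 10], by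
      norm_num [smallTriangle]⟩
  exact ENNReal.toReal_pos (h1.trans_le (measure_mono h)).ne' hA.measure_lt_top.ne

theorem sq_norm_le {x : Fin 2 → ℝ} {c : ℝ} (h0 : x 0 ^ 2 ≤ c) (h1 : x 1 ^ 2 ≤ c) : ‖x‖ ^ 2 ≤ c := by
  have hc : 0 ≤ c := (sq_nonneg _).trans h0
  rw [← Real.sq_sqrt hc]
  refine pow_le_pow_left₀ (norm_nonneg _) ((pi_norm_le_iff_of_nonneg (Real.sqrt_nonneg _)).2 ?_) 2
  rw [Fin.forall_fin_two]
  exact ⟨Real.abs_le_sqrt h0, Real.abs_le_sqrt h1⟩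

theorem isBounded_of_bound {A : Set (Fin 2 → ℝ)} {F : (Fin 2 → ℝ) → ℝ} {C : ℝ} (hC : 0 ≤ C)
    (hb : ∀ x ∈ A, ‖x‖ ^ 2 ≤ C * F x) : Bornology.IsBounded {x ∈ A | F x ≤ 1} := by
  refine isBounded_iff_forall_norm_le.2 ⟨C + 1, fun x hx => ?_⟩
  have h1 := hb x hx.1
  have h2 := mul_le_mul_of_nonneg_left hx.2 hC
  nlinarith [sq_nonneg (‖x‖ - 1), norm_nonneg x]

theorem volume_frontier_inter {A B : Set (Fin 2 → ℝ)} (hA : volume (frontier A) = 0)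
    (hB : volume (frontier B) = 0) : volume (frontier (A ∩ B)) = 0 :=
  measure_mono_null ((frontier_inter_subset A B).trans
    (Set.union_subset_union Set.inter_subset_left Set.inter_subset_right))
    (measure_union_null hA hB)

/-- Convex sets have null frontier. The sublevel sets of `xy` need not be convex, but inside the
cone they are complements of this convex set, which serves as well. -/
theorem convex_hyperbola : Convex ℝ {x : Fin 2 → ℝ | 0 < x 0 ∧ 0 < x 1 ∧ 1 < x 0 * x 1} := by
  rintro x ⟨h0, h1, h2⟩ y ⟨k0, k1, k2⟩ a b ha hb hab
  -- The two cross terms have product greater than `1`, so their sum exceeds `2` by the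
  -- arithmetic-geometric mean inequality.
  have key : 2 < x 0 * y 1 + x 1 * y 0 := by
    have e1 : 1 < (x 0 * y 1) * (x 1 * y 0) := by
      have := mul_lt_mul'' h2 k2 zero_le_one zero_le_one
      nlinarith
    have p1 : 0 < x 0 * y 1 := by positivity
    have p2 : 0 < x 1 * y 0 := by positivity
    nlinarith [sq_nonneg (x 0 * y 1 - x 1 * y 0)]
  simp only [Set.mem_ofPred_eq, Pi.add_apply, Pi.smul_apply, smul_eq_mul]
  rcases ha.eq_or_lt with rfl | ha'
  · obtain rfl : b = 1 := by linarith
    simpa using ⟨k0, k1, k2⟩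
  refine ⟨by positivity, by positivity, ?_⟩
  have e2 : (a + b) ^ 2 = 1 := by rw [hab]; norm_num
  have e3 : a ^ 2 * 1 < a ^ 2 * (x 0 * x 1) := mul_lt_mul_of_pos_left h2 (by positivity)
  have e4 : b ^ 2 * 1 ≤ b ^ 2 * (y 0 * y 1) := mul_le_mul_of_nonneg_left k2.le (by positivity)
  have e5 : a * b * 2 ≤ a * b * (x 0 * y 1 + x 1 * y 0) :=
    mul_le_mul_of_nonneg_left key.le (by positivity)
  nlinarith

theorem convex_disc : Convex ℝ {x : Fin 2 → ℝ | x 0 ^ 2 + x 1 ^ 2 ≤ 1} := by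
  intro x hx y hy a b ha hb hab
  simp only [Set.mem_ofPred_eq, Pi.add_apply, Pi.smul_apply, smul_eq_mul] at hx hy ⊢
  have e2 : (a + b) ^ 2 = 1 := by rw [hab]; norm_num
  nlinarith [mul_le_mul_of_nonneg_left hx ha, mul_le_mul_of_nonneg_left hy hb,
    mul_nonneg (mul_nonneg ha hb) (sq_nonneg (x 0 - y 0)),
    mul_nonneg (mul_nonneg ha hb) (sq_nonneg (x 1 - y 1))]

theorem countingCone_sq {X : Set (Fin 2 → ℝ)} (hX : MeasurableSet X) (hc : Convex ℝ X)
    (hs : ∀ ⦃x⦄ ⦃r : ℝ⦄, x ∈ X → 0 < r → r • x ∈ X) (h0 : 0 ∉ X) (ht : smallTriangle ⊆ X) :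
    CountingCone X fun x => x 0 ^ 2 + x 1 ^ 2 := by
  have hb : ∀ x ∈ X, ‖x‖ ^ 2 ≤ 1 * (x 0 ^ 2 + x 1 ^ 2) := fun x _ =>
    sq_norm_le (by nlinarith [sq_nonneg (x 1)]) (by nlinarith [sq_nonneg (x 0)])
  refine ⟨hs, fun x r hr => ?_, ⟨1, zero_le_one, hb⟩, ?_, ?_, ?_, fun v hv => ?_⟩
  · simp only [Pi.smul_apply, smul_eq_mul]
    ring
  · exact hX.inter (measurableSet_le (f := fun x : Fin 2 → ℝ => x 0 ^ 2 + x 1 ^ 2)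
      (by fun_prop) measurable_const)
  · exact volume_frontier_inter (hc.addHaar_frontier _) (convex_disc.addHaar_frontier _)
  · refine volume_real_pos (isBounded_of_bound zero_le_one hb) fun x hx => ⟨ht hx, ?_⟩
    obtain ⟨h1, h2, h3, h4⟩ := hx
    nlinarith
  · refine ⟨(v.1 ^ 2 + v.2 ^ 2).toNat, ?_, ?_⟩
    · have : ¬ (v.1 = 0 ∧ v.2 = 0) := fun h => h0 (by
        convert hv
        ext i
        fin_cases i <;> simp [intPoint, h.1, h.2])
      rw [Int.lt_toNat]
      by_contra! hle
      exact this ⟨by push_cast at hle; nlinarith [sq_nonneg v.1, sq_nonneg v.2],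
        by push_cast at hle; nlinarith [sq_nonneg v.1, sq_nonneg v.2]⟩
    · have : (((v.1 ^ 2 + v.2 ^ 2).toNat : ℤ) : ℝ) = ((v.1 ^ 2 + v.2 ^ 2 : ℤ) : ℝ) := by
        rw [Int.toNat_of_nonneg (by positivity)]
      simp only [intPoint, Matrix.cons_val_zero, Matrix.cons_val_one]
      rw [Int.cast_natCast] at this
      rw [this]
      push_cast
      rfl

/-- The product `xy` does not bound the norm near the axes. The ratio bounds in `hpos` keep the cone
away from them and give `‖x‖² ≤ 2 x₀ x₁`. -/
theorem countingCone_mul {X : Set (Fin 2 → ℝ)} (hX : MeasurableSet X) (hc : Convex ℝ X)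
    (hs : ∀ ⦃x⦄ ⦃r : ℝ⦄, x ∈ X → 0 < r → r • x ∈ X)
    (hpos : ∀ x ∈ X, 0 < x 0 ∧ 0 < x 1 ∧ x 0 ≤ 2 * x 1 ∧ x 1 ≤ 2 * x 0)
    (ht : smallTriangle ⊆ X) :
    CountingCone X fun x => x 0 * x 1 := by
  have hb : ∀ x ∈ X, ‖x‖ ^ 2 ≤ 2 * (x 0 * x 1) := fun x hx => by
    obtain ⟨h1, h2, h3, h4⟩ := hpos x hx
    exact sq_norm_le (by nlinarith) (by nlinarith)
  refine ⟨hs, fun x r hr => ?_, ⟨2, zero_le_two, hb⟩, ?_, ?_, ?_, fun v hv => ?_⟩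
  · simp only [Pi.smul_apply, smul_eq_mul]
    ring
  · exact hX.inter (measurableSet_le (f := fun x : Fin 2 → ℝ => x 0 * x 1)
      (by fun_prop) measurable_const)
  · have : {x ∈ X | x 0 * x 1 ≤ 1} =
        X ∩ {x : Fin 2 → ℝ | 0 < x 0 ∧ 0 < x 1 ∧ 1 < x 0 * x 1}ᶜ := by
      ext x
      refine and_congr_right fun hx => ?_
      obtain ⟨h1, h2, -⟩ := hpos x hx
      simp [h1, h2]
    rw [this]
    refine volume_frontier_inter (hc.addHaar_frontier _) ?_
    rw [frontier_compl]
    exact convex_hyperbola.addHaar_frontier _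
  · refine volume_real_pos (isBounded_of_bound zero_le_two hb) fun x hx => ⟨ht hx, ?_⟩
    obtain ⟨h1, h2, h3, h4⟩ := hx
    nlinarith
  · obtain ⟨h1, h2, -⟩ := hpos _ hv
    simp only [intPoint, Matrix.cons_val_zero, Matrix.cons_val_one, Int.cast_pos] at h1 h2 ⊢
    obtain ⟨a, ha⟩ := Int.eq_ofNat_of_zero_le h1.le
    obtain ⟨b, hb⟩ := Int.eq_ofNat_of_zero_le h2.le
    refine ⟨a * b, Nat.mul_pos (by omega) (by omega), ?_⟩
    rw [ha, hb]
    push_cast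
    rfl

theorem sqrt_three_bounds : (3 / 2 : ℝ) < √3 ∧ √3 < 2 := by
  constructor
  · exact Real.lt_sqrt_of_sq_lt (by norm_num)
  · rw [Real.sqrt_lt' two_pos]
    norm_num

/-- The vectors `(x, y)` with `0 < y ≤ x < √3 y`. -/
def halfSector : Set (Fin 2 → ℝ) := {x | 0 < x 1 ∧ x 1 ≤ x 0 ∧ x 0 < √3 * x 1}

/-- The vectors `(x, y)` with `x < √3 y` and `y < √3 x`. -/
def sector : Set (Fin 2 → ℝ) := {x | x 0 < √3 * x 1 ∧ x 1 < √3 * x 0}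

/-- The vectors `(x, y)` with `0 < x` and `0 ≤ y`. -/
def quadrant : Set (Fin 2 → ℝ) := {x | 0 < x 0 ∧ 0 ≤ x 1}

theorem convex_setOf_lt (f g : (Fin 2 → ℝ) →ₗ[ℝ] ℝ) : Convex ℝ {x | f x < g x} := by
  have : {x | f x < g x} = (g - f) ⁻¹' Set.Ioi 0 := by
    ext x
    simp
  rw [this]
  exact (convex_Ioi (0 : ℝ)).linear_preimage (g - f)

theorem convex_setOf_le (f g : (Fin 2 → ℝ) →ₗ[ℝ] ℝ) : Convex ℝ {x | f x ≤ g x} := by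
  have : {x | f x ≤ g x} = (g - f) ⁻¹' Set.Ici 0 := by
    ext x
    simp
  rw [this]
  exact (convex_Ici (0 : ℝ)).linear_preimage (g - f)

theorem measurableSet_halfSector : MeasurableSet halfSector :=
  (measurableSet_lt measurable_const (measurable_pi_apply 1)).inter
    ((measurableSet_le (measurable_pi_apply 1) (measurable_pi_apply 0)).inter
      (measurableSet_lt (measurable_pi_apply 0) ((measurable_pi_apply 1).const_mul _)))

theorem measurableSet_sector : MeasurableSet sector :=
  (measurableSet_lt (measurable_pi_apply 0) ((measurable_pi_apply 1).const_mul _)).inter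
    (measurableSet_lt (measurable_pi_apply 1) ((measurable_pi_apply 0).const_mul _))

theorem measurableSet_quadrant : MeasurableSet quadrant :=
  (measurableSet_lt measurable_const (measurable_pi_apply 0)).inter
    (measurableSet_le measurable_const (measurable_pi_apply 1))

theorem convex_halfSector : Convex ℝ halfSector := by
  have h := convex_setOf_lt (LinearMap.proj 0) (√3 • LinearMap.proj 1)
  simp only [LinearMap.proj_apply, LinearMap.smul_apply, smul_eq_mul] at h
  exact (convex_setOf_lt 0 (LinearMap.proj 1)).inter
    ((convex_setOf_le (LinearMap.proj 1) (LinearMap.proj 0)).inter h)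

theorem convex_sector : Convex ℝ sector := by
  have h := convex_setOf_lt (LinearMap.proj 0) (√3 • LinearMap.proj 1)
  have h' := convex_setOf_lt (LinearMap.proj 1) (√3 • LinearMap.proj 0)
  simp only [LinearMap.proj_apply, LinearMap.smul_apply, smul_eq_mul] at h h'
  exact h.inter h'

theorem convex_quadrant : Convex ℝ quadrant :=
  (convex_setOf_lt 0 (LinearMap.proj 0)).inter (convex_setOf_le 0 (LinearMap.proj 1))

theorem smul_mem_halfSector ⦃x : Fin 2 → ℝ⦄ ⦃r : ℝ⦄ (hx : x ∈ halfSector) (hr : 0 < r) :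
    r • x ∈ halfSector := by
  obtain ⟨h0, h1, h2⟩ := hx
  refine ⟨mul_pos hr h0, mul_le_mul_of_nonneg_left h1 hr.le, ?_⟩
  have := mul_lt_mul_of_pos_left h2 hr
  simp only [Pi.smul_apply, smul_eq_mul]
  linarith

theorem smul_mem_sector ⦃x : Fin 2 → ℝ⦄ ⦃r : ℝ⦄ (hx : x ∈ sector) (hr : 0 < r) :
    r • x ∈ sector := by
  obtain ⟨h1, h2⟩ := hx
  have := mul_lt_mul_of_pos_left h2 hr
  have := mul_lt_mul_of_pos_left h1 hr
  constructor <;> simp only [Pi.smul_apply, smul_eq_mul] <;> linarith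

theorem smul_mem_quadrant ⦃x : Fin 2 → ℝ⦄ ⦃r : ℝ⦄ (hx : x ∈ quadrant) (hr : 0 < r) :
    r • x ∈ quadrant :=
  ⟨mul_pos hr hx.1, mul_nonneg hr.le hx.2⟩

/-- The two inequalities chain to `x₀ < √3 x₁ < 3 x₀`, which forces positivity; the ratio bounds
follow from `√3 < 2`. -/
theorem pos_of_mem_sector {x : Fin 2 → ℝ} (hx : x ∈ sector) :
    0 < x 0 ∧ 0 < x 1 ∧ x 0 ≤ 2 * x 1 ∧ x 1 ≤ 2 * x 0 := by
  obtain ⟨h1, h2⟩ := hx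
  obtain ⟨h3, h4⟩ := sqrt_three_bounds
  have h5 : √3 * √3 = 3 := Real.mul_self_sqrt (by norm_num)
  have h6 : 0 < x 0 := by nlinarith
  have h7 : 0 < x 1 := by nlinarith
  exact ⟨h6, h7, by nlinarith, by nlinarith⟩

theorem halfSector_subset : halfSector ⊆ sector := by
  rintro x ⟨h0, h1, h2⟩
  refine ⟨h2, ?_⟩
  nlinarith [sqrt_three_bounds.1]

theorem smallTriangle_subset : smallTriangle ⊆ halfSector := by
  rintro x ⟨h0, h1, h2, h3⟩
  refine ⟨h0, h1.le, ?_⟩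
  nlinarith [sqrt_three_bounds.1]

theorem countingCone_halfSector_sq : CountingCone halfSector fun x => x 0 ^ 2 + x 1 ^ 2 :=
  countingCone_sq measurableSet_halfSector convex_halfSector smul_mem_halfSector
    (fun h => lt_irrefl _ h.1) smallTriangle_subset

theorem countingCone_halfSector_mul : CountingCone halfSector fun x => x 0 * x 1 :=
  countingCone_mul measurableSet_halfSector convex_halfSector smul_mem_halfSector
    (fun _ h => pos_of_mem_sector (halfSector_subset h)) smallTriangle_subset

theorem countingCone_sector_sq : CountingCone sector fun x => x 0 ^ 2 + x 1 ^ 2 :=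
  countingCone_sq measurableSet_sector convex_sector smul_mem_sector
    (fun h => lt_irrefl _ (pos_of_mem_sector h).1) (smallTriangle_subset.trans halfSector_subset)

theorem countingCone_sector_mul : CountingCone sector fun x => x 0 * x 1 :=
  countingCone_mul measurableSet_sector convex_sector smul_mem_sector
    (fun _ h => pos_of_mem_sector h) (smallTriangle_subset.trans halfSector_subset)

theorem countingCone_quadrant : CountingCone quadrant fun x => x 0 ^ 2 + x 1 ^ 2 :=
  countingCone_sq measurableSet_quadrant convex_quadrant smul_mem_quadrant
    (fun h => lt_irrefl _ h.1) fun _ hx => ⟨hx.1.trans hx.2.1, hx.1.le⟩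

theorem intPoint_mem_quadrant {v : ℤ × ℤ} : intPoint v ∈ quadrant ↔ 0 < v.1 ∧ 0 ≤ v.2 := by
  simp [quadrant, intPoint]

theorem lt_sqrt_three_mul_iff {a b : ℝ} (ha : 0 ≤ a) (hb : 0 ≤ b) :
    a < √3 * b ↔ a ^ 2 < 3 * b ^ 2 := by
  rw [← Real.sqrt_sq hb, ← Real.sqrt_mul (by norm_num), Real.lt_sqrt ha, Real.sqrt_sq hb]

theorem intPoint_mem_sector {v : ℤ × ℤ} : intPoint v ∈ sector ↔
    0 < v.1 ∧ 0 < v.2 ∧ v.1 ^ 2 < 3 * v.2 ^ 2 ∧ v.2 ^ 2 < 3 * v.1 ^ 2 := by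
  constructor
  · intro h
    obtain ⟨h0, h1, -⟩ := pos_of_mem_sector h
    obtain ⟨h2, h3⟩ := h
    rw [lt_sqrt_three_mul_iff (by positivity) (by positivity)] at h2 h3
    simp only [intPoint, Matrix.cons_val_zero, Matrix.cons_val_one] at h0 h1 h2 h3
    exact ⟨by exact_mod_cast h0, by exact_mod_cast h1, by exact_mod_cast h2, by exact_mod_cast h3⟩
  · rintro ⟨h0, h1, h2, h3⟩
    have h0' : (0 : ℝ) < v.1 := by exact_mod_cast h0
    have h1' : (0 : ℝ) < v.2 := by exact_mod_cast h1
    refine ⟨(lt_sqrt_three_mul_iff h0'.le h1'.le).2 ?_, (lt_sqrt_three_mul_iff h1'.le h0'.le).2 ?_⟩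
    · exact_mod_cast h2
    · exact_mod_cast h3

theorem intPoint_mem_halfSector {v : ℤ × ℤ} : intPoint v ∈ halfSector ↔
    0 < v.2 ∧ v.2 ≤ v.1 ∧ v.1 ^ 2 < 3 * v.2 ^ 2 := by
  constructor
  · intro h
    have h2 := intPoint_mem_sector.1 (halfSector_subset h)
    exact ⟨h2.2.1, by simpa [intPoint] using h.2.1, h2.2.2.1⟩
  · rintro ⟨h0, h1, h2⟩
    refine ⟨by simpa [intPoint] using h0, by simpa [intPoint] using h1, ?_⟩
    exact (intPoint_mem_sector.2 ⟨h0.trans_le h1, h0, h2, by nlinarith⟩).1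

/-! ### Parametrisation of `𝒮` by primitive pairs -/

theorem eq_of_mul_eq_mul_of_isCoprime {p q p' q' : ℤ} (hp : 0 < p) (hp' : 0 < p')
    (h : IsCoprime p q) (h' : IsCoprime p' q') (e : p * q' = p' * q) :
    p = p' ∧ q = q' := by
  have h1 : p = p' := Int.dvd_antisymm hp.le hp'.le
    (h.dvd_of_dvd_mul_right (e ▸ dvd_mul_right _ _)) (h'.dvd_of_dvd_mul_right (e ▸ dvd_mul_right _ _))
  subst h1
  exact ⟨rfl, (mul_left_cancel₀ hp.ne' e).symm⟩

theorem isCoprime_mul_sq_add_sq {m n : ℤ} (h : IsCoprime m n) : IsCoprime (m * n) (m ^ 2 + n ^ 2) := by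
  refine IsCoprime.mul_left ?_ ?_
  · rw [show m ^ 2 + n ^ 2 = n ^ 2 + m * m by ring]
    exact h.pow_right.add_mul_left_right m
  · rw [show m ^ 2 + n ^ 2 = m ^ 2 + n * n by ring]
    exact h.symm.pow_right.add_mul_left_right n

/-- Squaring removes the radicals. The exceptional pair `(1, 1)` becomes the case `t = 0`, since `p
= q` and coprimality force `p = q = 1`. -/
theorem mem_fareyPairs_iff {p q : ℕ} : (p, q) ∈ fareyPairs ↔ 0 < p ∧ p ≤ q ∧
    IsCoprime (p : ℤ) (q : ℤ) ∧ 3 * (q : ℤ) ^ 2 < 4 * (p : ℤ) ^ 2 ∧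
      ∃ t : ℕ, (t : ℤ) ^ 2 + (p : ℤ) ^ 2 = (q : ℤ) ^ 2 := by
  rw [Nat.isCoprime_iff_coprime]
  constructor
  · rintro (⟨hq, hg, h1, h2, t, ht⟩ | h)
    · have hq' : (0 : ℝ) < q := Nat.cast_pos.2 hq
      simp only at hq hg h1 h2 ht
      rw [div_lt_div_iff₀ two_pos hq', lt_iff_exists_pos_add] at h1
      rw [div_lt_one hq', Nat.cast_lt] at h2
      obtain ⟨c, hc, h1⟩ := h1
      have h5 : √3 * √3 = 3 := Real.mul_self_sqrt (by norm_num)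
      have h6 : 0 ≤ √3 := Real.sqrt_nonneg _
      have h3 : 3 * (q : ℝ) ^ 2 < 4 * (p : ℝ) ^ 2 := by
        have : 0 ≤ √3 * q * c := by positivity
        nlinarith
      have h3' : 3 * (q : ℤ) ^ 2 < 4 * (p : ℤ) ^ 2 := by exact_mod_cast h3
      refine ⟨?_, h2.le, hg, h3', t, ?_⟩
      · rcases Nat.eq_zero_or_pos p with rfl | hp
        · have : (0 : ℤ) ≤ (q : ℤ) ^ 2 := sq_nonneg _
          push_cast at h3'
          linarith
        · exact hp
      · have h7 : (0 : ℝ) ≤ (q : ℝ) ^ 2 - (p : ℝ) ^ 2 := by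
          have : (p : ℝ) ≤ q := by exact_mod_cast h2.le
          nlinarith [(Nat.cast_nonneg p : (0 : ℝ) ≤ p)]
        have h8 := Real.sq_sqrt h7
        rw [ht] at h8
        have : (t : ℝ) ^ 2 + (p : ℝ) ^ 2 = (q : ℝ) ^ 2 := by linarith
        exact_mod_cast this
    · obtain ⟨rfl, rfl⟩ : p = 1 ∧ q = 1 := by simpa using h
      exact ⟨one_pos, le_rfl, Nat.coprime_one_left 1, by norm_num, 0, by norm_num⟩
  · rintro ⟨hp, hle, hg, h3, t, ht⟩
    rcases hle.eq_or_lt with rfl | hlt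
    · right
      rw [Nat.coprime_self] at hg
      simp [hg]
    · left
      have hq : 0 < q := hp.trans_le hle
      have hq' : (0 : ℝ) < q := Nat.cast_pos.2 hq
      refine ⟨hq, hg, ?_, ?_, t, ?_⟩
      · rw [div_lt_div_iff₀ two_pos hq', mul_comm (p : ℝ)]
        have h4 : 3 * (q : ℝ) ^ 2 < 4 * (p : ℝ) ^ 2 := by exact_mod_cast h3
        refine lt_of_pow_lt_pow_left₀ 2 (by positivity) ?_
        rw [mul_pow, Real.sq_sqrt (by norm_num)]
        linarith
      · rw [div_lt_one hq']
        exact_mod_cast hlt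
      · have : (q : ℝ) ^ 2 - (p : ℝ) ^ 2 = (t : ℝ) ^ 2 := by
          rw [sub_eq_iff_eq_add]
          exact_mod_cast ht.symm
        simp only
        rw [this, Real.sqrt_sq (Nat.cast_nonneg _)]

/-- Coprime pairs in the half sector of a given kind. -/
abbrev primitivePairs (P : ℤ × ℤ → Prop) : Type :=
  {v : ℤ × ℤ // intPoint v ∈ halfSector ∧ P v ∧ Int.gcd v.1 v.2 = 1}

/-- The factor `c` is the one to cancel from the triple `2mn, m² + n², m² - n²`: it is `1` for
opposite parities and `2` for two odd numbers. The bound `p/q > √3/2` holds because `4(2mn)² - 3(m²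
+ n²)² = (3m² - n²)(3n² - m²)`. -/
theorem toNat_mem_fareyPairs {m n p q t : ℤ} (h : 0 < n ∧ n ≤ m ∧ m ^ 2 < 3 * n ^ 2)
    {c : ℤ} (hc : 0 < c) (hp : c * p = 2 * (m * n)) (hq : c * q = m ^ 2 + n ^ 2)
    (ht : c * t = m ^ 2 - n ^ 2) (hpq : IsCoprime p q) : (p.toNat, q.toNat) ∈ fareyPairs := by
  obtain ⟨h0, h1, h2⟩ := h
  have hm : 0 < m := h0.trans_le h1
  have hp0 : 0 < p := by
    refine pos_of_mul_pos_right (a := c) ?_ hc.le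
    rw [hp]
    positivity
  have hq0 : 0 < q := by
    refine pos_of_mul_pos_right (a := c) ?_ hc.le
    rw [hq]
    positivity
  have ht0 : 0 ≤ t := by
    refine nonneg_of_mul_nonneg_right (a := c) ?_ hc
    rw [ht]
    nlinarith
  rw [mem_fareyPairs_iff, Int.toNat_of_nonneg hp0.le, Int.toNat_of_nonneg hq0.le]
  refine ⟨by omega, ?_, hpq, ?_, t.toNat, ?_⟩
  · refine Int.toNat_le_toNat (le_of_mul_le_mul_left (a := c) ?_ hc)
    rw [hp, hq]
    nlinarith [sq_nonneg (m - n)]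
  · refine lt_of_mul_lt_mul_left (a := c ^ 2) ?_ (by positivity)
    have e1 : c ^ 2 * (3 * q ^ 2) = 3 * (m ^ 2 + n ^ 2) ^ 2 := by rw [← hq]; ring
    have e2 : c ^ 2 * (4 * p ^ 2) = 4 * (2 * (m * n)) ^ 2 := by rw [← hp]; ring
    rw [e1, e2]
    have h3 : 0 < 3 * m ^ 2 - n ^ 2 := by nlinarith
    nlinarith
  · rw [Int.toNat_of_nonneg ht0]
    refine mul_left_cancel₀ (pow_ne_zero 2 hc.ne') (?_ : c ^ 2 * _ = c ^ 2 * _)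
    have : (c * t) ^ 2 + (c * p) ^ 2 = (c * q) ^ 2 := by
      rw [hp, hq, ht]
      ring
    linarith

theorem isCoprime_of_odd_add {m n : ℤ} (h : Odd (m + n)) (hg : Int.gcd m n = 1) :
    IsCoprime (2 * (m * n)) (m ^ 2 + n ^ 2) := by
  refine IsCoprime.mul_left ?_ (isCoprime_mul_sq_add_sq (Int.isCoprime_iff_gcd_eq_one.2 hg))
  have : Odd (m ^ 2 + n ^ 2) := by
    rw [← Int.not_even_iff_odd, Int.even_add] at h ⊢
    simpa [Int.even_pow] using h
  exact Int.isCoprime_two_left.2 this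

theorem odd_odd_half {m n : ℤ} (h : Odd m ∧ Odd n) (hg : Int.gcd m n = 1) :
    ∃ k l, m ^ 2 + n ^ 2 = 2 * k ∧ m ^ 2 - n ^ 2 = 2 * l ∧ IsCoprime (m * n) k := by
  obtain ⟨k, hk⟩ := (h.1.pow (n := 2)).add_odd (h.2.pow (n := 2))
  obtain ⟨l, hl⟩ := (h.1.pow (n := 2)).sub_odd (h.2.pow (n := 2))
  have hk' : m ^ 2 + n ^ 2 = 2 * k := by omega
  refine ⟨k, l, hk', by omega, ?_⟩
  have := isCoprime_mul_sq_add_sq (Int.isCoprime_iff_gcd_eq_one.2 hg)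
  rw [hk'] at this
  exact this.of_mul_right_right

/-- The pair `(p, q)` with `p / q = 2 m n / (m² + n²)` in lowest terms. -/
def fareyOfPrimitive :
    primitivePairs (fun v => Odd (v.1 + v.2)) ⊕ primitivePairs (fun v => Odd v.1 ∧ Odd v.2) →
      fareyPairs
  | Sum.inl v => ⟨((2 * (v.1.1 * v.1.2)).toNat, (v.1.1 ^ 2 + v.1.2 ^ 2).toNat),
      toNat_mem_fareyPairs (intPoint_mem_halfSector.1 v.2.1) one_pos (one_mul _) (one_mul _)
        (one_mul _) (isCoprime_of_odd_add v.2.2.1 v.2.2.2)⟩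
  | Sum.inr v => ⟨((v.1.1 * v.1.2).toNat, ((v.1.1 ^ 2 + v.1.2 ^ 2) / 2).toNat), by
      obtain ⟨k, l, hk, hl, hkl⟩ := odd_odd_half v.2.2.1 v.2.2.2
      rw [hk, Int.mul_ediv_cancel_left _ two_ne_zero]
      exact toNat_mem_fareyPairs (intPoint_mem_halfSector.1 v.2.1) two_pos rfl hk.symm hl.symm hkl⟩

/-- The underlying pair of integers. -/
def primitiveVector :
    primitivePairs (fun v => Odd (v.1 + v.2)) ⊕ primitivePairs (fun v => Odd v.1 ∧ Odd v.2) →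
      ℤ × ℤ :=
  Sum.elim Subtype.val Subtype.val

theorem primitiveVector_injective : Function.Injective primitiveVector := by
  rintro (v | v) (w | w) h
  · exact congrArg Sum.inl (Subtype.ext h)
  · have hv := v.2.2.1
    rw [show v.1 = w.1 from h] at hv
    exact absurd (w.2.2.1.1.add_odd w.2.2.1.2) (Int.not_even_iff_odd.2 hv)
  · have hw := w.2.2.1
    rw [← show v.1 = w.1 from h] at hw
    exact absurd (v.2.2.1.1.add_odd v.2.2.1.2) (Int.not_even_iff_odd.2 hw)
  · exact congrArg Sum.inr (Subtype.ext h)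

/-- Carrying the factor `c` along lets the proof of injectivity treat both parity cases at once. -/
theorem primitiveVector_spec (z : primitivePairs (fun v => Odd (v.1 + v.2)) ⊕
    primitivePairs (fun v => Odd v.1 ∧ Odd v.2)) :
    (0 < (primitiveVector z).2 ∧ (primitiveVector z).2 ≤ (primitiveVector z).1) ∧
      IsCoprime (primitiveVector z).1 (primitiveVector z).2 ∧
      ∃ c : ℤ, 0 < c ∧
        c * (fareyOfPrimitive z).1.1 = 2 * ((primitiveVector z).1 * (primitiveVector z).2) ∧
        c * (fareyOfPrimitive z).1.2 = (primitiveVector z).1 ^ 2 + (primitiveVector z).2 ^ 2 := by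
  rcases z with ⟨⟨m, n⟩, hv, hP, hg⟩ | ⟨⟨m, n⟩, hv, hP, hg⟩ <;>
    obtain ⟨h0, h1, h2⟩ := intPoint_mem_halfSector.1 hv <;>
    refine ⟨⟨h0, h1⟩, Int.isCoprime_iff_gcd_eq_one.2 hg, ?_⟩ <;>
    have hm := h0.trans_le h1 <;> simp only at h0 h1 h2 hm hP hg
  · refine ⟨1, one_pos, ?_, ?_⟩ <;> simp only [fareyOfPrimitive, primitiveVector, Sum.elim_inl]
    · rw [Int.toNat_of_nonneg (by positivity), one_mul]
    · rw [Int.toNat_of_nonneg (by positivity), one_mul]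
  · obtain ⟨k, l, hk, hl, hkl⟩ := odd_odd_half hP hg
    refine ⟨2, two_pos, ?_, ?_⟩ <;> simp only [fareyOfPrimitive, primitiveVector, Sum.elim_inr]
    · rw [Int.toNat_of_nonneg (by positivity)]
    · rw [Int.toNat_of_nonneg (by positivity), hk, Int.mul_ediv_cancel_left _ two_ne_zero]

theorem fareyOfPrimitive_injective : Function.Injective fareyOfPrimitive := by
  intro z z' h
  refine primitiveVector_injective ?_
  obtain ⟨⟨h0, h1⟩, hc, c, hc0, hp, hq⟩ := primitiveVector_spec z
  obtain ⟨⟨h0', h1'⟩, hc', c', hc0', hp', hq'⟩ := primitiveVector_spec z'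
  rw [← h] at hp' hq'
  generalize primitiveVector z = v at *
  generalize primitiveVector z' = v' at *
  generalize ((fareyOfPrimitive z).1.1 : ℤ) = p at *
  generalize ((fareyOfPrimitive z).1.2 : ℤ) = q at *
  obtain ⟨m, n⟩ := v
  obtain ⟨m', n'⟩ := v'
  simp only at *
  have hm := h0.trans_le h1
  have hm' := h0'.trans_le h1'
  have e1 : c * c' * (2 * (m * n) * (m' ^ 2 + n' ^ 2)) =
      c * c' * (2 * (m' * n') * (m ^ 2 + n ^ 2)) := by
    rw [← hp, ← hq, ← hp', ← hq']
    ring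
  have e2 := mul_left_cancel₀ (mul_pos hc0 hc0').ne' e1
  -- The difference of the two cross products factors. As `n ≤ m` and `n' ≤ m'`, the first factor
  -- vanishes only if `m = n` and `m' = n'`.
  have e3 : (m * m' - n * n') * (m' * n - m * n') = 0 := by linarith
  have e4 : m * n' = m' * n := by
    rcases mul_eq_zero.1 e3 with h | h
    · obtain rfl : m = n := by nlinarith
      obtain rfl : m' = n' := by nlinarith
      ring
    · linarith
  obtain ⟨rfl, rfl⟩ := eq_of_mul_eq_mul_of_isCoprime hm hm' hc hc' e4
  rfl

/-- With `t² + p² = q²`, the pair `(m, n)` is the primitive vector in the direction `(q + t, p)`: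
the ratio `(q + t)/p` is the cotangent of half the angle whose sine is `p/q`. -/
theorem fareyOfPrimitive_surjective : Function.Surjective fareyOfPrimitive := by
  rintro ⟨⟨p, q⟩, hpq⟩
  obtain ⟨hp, hle, hcop, h3, t, ht⟩ := mem_fareyPairs_iff.1 hpq
  have hp' : (0 : ℤ) < p := by exact_mod_cast hp
  have hle' : (p : ℤ) ≤ q := by exact_mod_cast hle
  have hq' := hp'.trans_le hle'
  have ht' : (0 : ℤ) ≤ t := Nat.cast_nonneg _
  have hg : 0 < Int.gcd ((q : ℤ) + t) p := Int.gcd_pos_iff.2 (Or.inr hp'.ne')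
  obtain ⟨m, n, hmn, hm, hn⟩ := Int.exists_gcd_one hg
  generalize Int.gcd ((q : ℤ) + t) p = g at *
  have hg' : (0 : ℤ) < g := by exact_mod_cast hg
  have hn0 : 0 < n := pos_of_mul_pos_left (hn ▸ hp') hg'.le
  have hnm : n ≤ m := le_of_mul_le_mul_right (a := (g : ℤ)) (by linarith) hg'
  have hm3 : m ^ 2 < 3 * n ^ 2 := by
    refine lt_of_mul_lt_mul_right (a := (g : ℤ) ^ 2) ?_ (by positivity)
    have e1 : m ^ 2 * (g : ℤ) ^ 2 = (q + t) ^ 2 := by rw [hm]; ring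
    have e2 : 3 * n ^ 2 * (g : ℤ) ^ 2 = 3 * p ^ 2 := by rw [hn]; ring
    rw [e1, e2]
    -- `4t² = 4q² - 4p² < q²`. Since `p² = (q - t)(q + t)`, the required `(q + t)² < 3p²` amounts to
    -- `q + t < 3(q - t)`.
    have : 2 * (t : ℤ) < q := by nlinarith
    nlinarith
  have e0 : (p : ℤ) * (m ^ 2 + n ^ 2) = 2 * (m * n) * q := by
    refine mul_right_cancel₀ (pow_ne_zero 2 hg'.ne') (?_ : _ * (g : ℤ) ^ 2 = _ * (g : ℤ) ^ 2)
    have e1 : (p : ℤ) * (m ^ 2 + n ^ 2) * (g : ℤ) ^ 2 = p * ((q + t) ^ 2 + p ^ 2) := by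
      rw [hm, hn]; ring
    have e2 : 2 * (m * n) * q * (g : ℤ) ^ 2 = 2 * ((q + t) * p) * q := by
      rw [hm, hn]; ring
    rw [e1, e2]
    linear_combination (p : ℤ) * ht
  have hmem := intPoint_mem_halfSector (v := (m, n)).2 ⟨hn0, hnm, hm3⟩
  have hm0 := hn0.trans_le hnm
  by_cases hodd : Odd (m + n)
  · obtain ⟨h1, h2⟩ := eq_of_mul_eq_mul_of_isCoprime hp' (by positivity) hcop
      (isCoprime_of_odd_add hodd hmn) e0
    refine ⟨Sum.inl ⟨(m, n), hmem, hodd, hmn⟩, Subtype.ext (Prod.ext ?_ ?_)⟩ <;>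
      simp only [fareyOfPrimitive] <;> omega
  · have hoo : Odd m ∧ Odd n := by
      have h2 : ¬ (Even m ∧ Even n) := fun h => by
        have := Int.dvd_coe_gcd h.1.two_dvd h.2.two_dvd
        rw [hmn] at this
        omega
      rw [Int.not_odd_iff_even, Int.even_add] at hodd
      rw [← Int.not_even_iff_odd, ← Int.not_even_iff_odd]
      tauto
    obtain ⟨k, l, hk, hl, hkl⟩ := odd_odd_half hoo hmn
    have hk0 : 0 < k := by nlinarith
    obtain ⟨h1, h2⟩ := eq_of_mul_eq_mul_of_isCoprime hp' (by positivity) hcop hkl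
      (by rw [hk] at e0; linarith)
    refine ⟨Sum.inr ⟨(m, n), hmem, hoo, hmn⟩, Subtype.ext (Prod.ext ?_ ?_)⟩ <;>
      simp only [fareyOfPrimitive]
    · omega
    · rw [hk, Int.mul_ediv_cancel_left _ two_ne_zero]
      omega

theorem exists_dirPole_fareyPairs_fst :
    ∃ l : ℝ, 0 < l ∧ DirPole (fun z : fareyPairs => (z.1.1 : ℝ)) 1 l := by
  obtain ⟨l, hl, h⟩ := countingCone_halfSector_mul.dirPole_coprime_odd_add
  obtain ⟨m, hm, h'⟩ := countingCone_halfSector_mul.dirPole_coprime_odd_odd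
  have h2 := h.const_mul (fun v => by
    obtain ⟨n, _, hn⟩ := countingCone_halfSector_mul.integral v.1 v.2.1
    rw [hn]
    positivity) two_pos
  refine ⟨2⁻¹ * l + m, by positivity, (h2.sumElim h').of_bijective (f := fareyOfPrimitive)
    ⟨fareyOfPrimitive_injective, fareyOfPrimitive_surjective⟩ ?_⟩
  rintro (⟨⟨m, n⟩, hv, hP, hg⟩ | ⟨⟨m, n⟩, hv, hP, hg⟩)
  all_goals
    obtain ⟨h0, h1, h2⟩ := intPoint_mem_halfSector.1 hv
    simp only at h0 h1
    have hm := h0.trans_le h1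
    simp only [fareyOfPrimitive, Sum.elim_inl, Sum.elim_inr, intPoint, Matrix.cons_val_zero,
      Matrix.cons_val_one]
    rw [← Int.cast_natCast, Int.toNat_of_nonneg (by positivity)]
    push_cast
    rfl

theorem exists_dirPole_fareyPairs_snd :
    ∃ l : ℝ, 0 < l ∧ DirPole (fun z : fareyPairs => (z.1.2 : ℝ)) 1 l := by
  obtain ⟨l, hl, h⟩ := countingCone_halfSector_sq.dirPole_coprime_odd_add
  obtain ⟨m, hm, h'⟩ := countingCone_halfSector_sq.dirPole_coprime_odd_odd
  have h2 := h'.const_mul (fun v => by positivity) (half_pos one_pos)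
  refine ⟨l + (1 / 2)⁻¹ * m, by positivity, (h.sumElim h2).of_bijective (f := fareyOfPrimitive)
    ⟨fareyOfPrimitive_injective, fareyOfPrimitive_surjective⟩ ?_⟩
  rintro (⟨⟨m, n⟩, hv, hP, hg⟩ | ⟨⟨m, n⟩, hv, hP, hg⟩)
  · simp only [fareyOfPrimitive, Sum.elim_inl, intPoint, Matrix.cons_val_zero,
      Matrix.cons_val_one]
    rw [← Int.cast_natCast, Int.toNat_of_nonneg (by positivity)]
    push_cast
    rfl
  · obtain ⟨k, l, hk, hl, hkl⟩ := odd_odd_half hP hg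
    simp only at hk
    have hk0 : 0 ≤ k := by nlinarith [sq_nonneg m, sq_nonneg n]
    simp only [fareyOfPrimitive, Sum.elim_inr, intPoint, Matrix.cons_val_zero,
      Matrix.cons_val_one]
    rw [hk, Int.mul_ediv_cancel_left _ two_ne_zero, ← Int.cast_natCast, Int.toNat_of_nonneg hk0]
    have : (m : ℝ) ^ 2 + (n : ℝ) ^ 2 = 2 * k := by exact_mod_cast hk
    rw [this]
    ring

/-! ### Reduced bases of planar lattices -/

/-- Vectors of equal length forming an angle strictly between `π / 3` and `2 π / 3`. -/
def IsReducedPair (x y : EuclideanSpace ℝ (Fin 2)) : Prop :=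
  ‖x‖ = ‖y‖ ∧ x ≠ 0 ∧ 2 * |inner ℝ x y| < ‖x‖ ^ 2

/-- If `i` and `j` are both nonzero, the value exceeds `(i² + j² - |ij|) N ≥ |ij| N ≥ N`. So only
`±1` on one of the axes attains the minimum. -/
theorem quadForm_bound {N c : ℝ} (hN : 0 < N) (hc : 2 * |c| < N) {i j : ℤ} (h : i ≠ 0 ∨ j ≠ 0) :
    N ≤ ((i : ℝ) ^ 2 + (j : ℝ) ^ 2) * N + 2 * (i * j) * c ∧
      (((i : ℝ) ^ 2 + (j : ℝ) ^ 2) * N + 2 * (i * j) * c ≤ N →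
        (i = 0 ∧ (j = 1 ∨ j = -1)) ∨ (j = 0 ∧ (i = 1 ∨ i = -1))) := by
  have sq_one : ∀ k : ℤ, k ≠ 0 → (1 : ℝ) ≤ (k : ℝ) ^ 2 := fun k hk => by
    have : 1 ≤ k ^ 2 := (one_le_sq_iff_one_le_abs _).2 (Int.one_le_abs hk)
    exact_mod_cast this
  have eq_one : ∀ k : ℤ, k ≠ 0 → (k : ℝ) ^ 2 * N ≤ N → k = 1 ∨ k = -1 := fun k hk h => by
    have h1 : (k : ℝ) ^ 2 ≤ 1 := by
      by_contra! hlt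
      nlinarith
    have h2 : k ^ 2 ≤ 1 := by exact_mod_cast h1
    have h3 := abs_le.1 ((sq_le_one_iff_abs_le_one k).1 h2)
    omega
  rcases eq_or_ne i 0 with rfl | hi
  · have hj : j ≠ 0 := by simpa using h
    have := sq_one j hj
    simp only [Int.cast_zero]
    refine ⟨by nlinarith, fun h => Or.inl ⟨trivial, eq_one j hj (by linarith)⟩⟩
  rcases eq_or_ne j 0 with rfl | hj
  · have := sq_one i hi
    simp only [Int.cast_zero]
    refine ⟨by nlinarith, fun h => Or.inr ⟨trivial, eq_one i hi (by linarith)⟩⟩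
  have hlt : N < ((i : ℝ) ^ 2 + (j : ℝ) ^ 2) * N + 2 * (i * j) * c := by
    have h1 : (1 : ℝ) ≤ |(i : ℝ) * j| := by
      have : 1 ≤ |i * j| := Int.one_le_abs (mul_ne_zero hi hj)
      exact_mod_cast this
    have h2 : -(|(i : ℝ) * j| * |c|) ≤ (i * j) * c := by
      rw [← abs_mul]
      exact neg_abs_le _
    have h3 : 2 * |(i : ℝ) * j| ≤ (i : ℝ) ^ 2 + (j : ℝ) ^ 2 := by
      rw [abs_mul]
      nlinarith [sq_nonneg (|(i : ℝ)| - |(j : ℝ)|), sq_abs (i : ℝ), sq_abs (j : ℝ)]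
    have h4 : |(i : ℝ) * j| * (2 * |c|) < |(i : ℝ) * j| * N :=
      mul_lt_mul_of_pos_left hc (by linarith)
    nlinarith
  exact ⟨hlt.le, fun h => absurd h (not_le.2 hlt)⟩

theorem span_pair_neg_left {E : Type*} [AddCommGroup E] (x y : E) :
    Submodule.span ℤ {-x, y} = Submodule.span ℤ {x, y} := by
  refine le_antisymm (Submodule.span_le.2 ?_) (Submodule.span_le.2 ?_) <;>
    rintro z (rfl | rfl)
  · exact neg_mem (Submodule.subset_span (by simp))
  · exact Submodule.subset_span (by simp)
  · rw [← neg_neg z]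
    exact neg_mem (Submodule.subset_span (by simp))
  · exact Submodule.subset_span (by simp)

theorem span_pair_neg_right {E : Type*} [AddCommGroup E] (x y : E) :
    Submodule.span ℤ {x, -y} = Submodule.span ℤ {x, y} := by
  rw [Set.pair_comm, span_pair_neg_left, Set.pair_comm]

namespace IsReducedPair

variable {x y : EuclideanSpace ℝ (Fin 2)}

theorem norm_pos (h : IsReducedPair x y) : 0 < ‖x‖ := norm_pos_iff.2 h.2.1

theorem symm (h : IsReducedPair x y) : IsReducedPair y x :=
  ⟨h.1.symm, norm_pos_iff.1 (h.1 ▸ h.norm_pos), by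
    rw [real_inner_comm, ← h.1]
    exact h.2.2⟩

theorem neg_right (h : IsReducedPair x y) : IsReducedPair x (-y) :=
  ⟨by rw [norm_neg, h.1], h.2.1, by
    rw [inner_neg_right, abs_neg]
    exact h.2.2⟩

theorem norm_sq_comb_real (h : IsReducedPair x y) (s t : ℝ) :
    ‖s • x + t • y‖ ^ 2 = (s ^ 2 + t ^ 2) * ‖x‖ ^ 2 + 2 * (s * t) * inner ℝ x y := by
  rw [norm_add_sq_real, norm_smul, norm_smul, inner_smul_left, inner_smul_right, ← h.1, mul_pow,
    mul_pow, Real.norm_eq_abs, Real.norm_eq_abs, sq_abs, sq_abs]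
  simp
  ring

theorem norm_sq_comb (h : IsReducedPair x y) (i j : ℤ) :
    ‖i • x + j • y‖ ^ 2 =
      ((i : ℝ) ^ 2 + (j : ℝ) ^ 2) * ‖x‖ ^ 2 + 2 * (i * j) * inner ℝ x y := by
  rw [← Int.cast_smul_eq_zsmul ℝ, ← Int.cast_smul_eq_zsmul ℝ, h.norm_sq_comb_real]

theorem norm_le (h : IsReducedPair x y) {v : EuclideanSpace ℝ (Fin 2)}
    (hv : v ∈ Submodule.span ℤ {x, y}) (h0 : v ≠ 0) : ‖x‖ ≤ ‖v‖ := by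
  obtain ⟨i, j, rfl⟩ := Submodule.mem_span_pair.1 hv
  refine le_of_sq_le_sq ?_ (norm_nonneg _)
  rw [h.norm_sq_comb]
  refine (quadForm_bound (pow_pos h.norm_pos 2) h.2.2 ?_).1
  by_contra! hij
  simp [hij.1, hij.2] at h0

theorem eq_of_norm_le (h : IsReducedPair x y) {v : EuclideanSpace ℝ (Fin 2)}
    (hv : v ∈ Submodule.span ℤ {x, y}) (h0 : v ≠ 0) (hle : ‖v‖ ≤ ‖x‖) :
    v = x ∨ v = -x ∨ v = y ∨ v = -y := by
  obtain ⟨i, j, rfl⟩ := Submodule.mem_span_pair.1 hv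
  have h1 : ‖i • x + j • y‖ ^ 2 ≤ ‖x‖ ^ 2 := pow_le_pow_left₀ (norm_nonneg _) hle 2
  rw [h.norm_sq_comb] at h1
  have h2 := (quadForm_bound (pow_pos h.norm_pos 2) h.2.2 (i := i) (j := j) (by
    by_contra! hij
    simp [hij.1, hij.2] at h0)).2 h1
  rcases h2 with ⟨rfl, rfl | rfl⟩ | ⟨rfl, rfl | rfl⟩ <;> simp

theorem eq_zero_of_comb (h : IsReducedPair x y) {i j : ℤ} (hij : i • x + j • y = 0) :
    i = 0 ∧ j = 0 := by
  by_contra hne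
  have h1 := (quadForm_bound (pow_pos h.norm_pos 2) h.2.2 (i := i) (j := j) (by tauto)).1
  rw [← h.norm_sq_comb, hij] at h1
  have := pow_pos h.norm_pos 2
  simp at h1
  exact h.2.1 h1

theorem latticeMin_eq (h : IsReducedPair x y) : latticeMin (Submodule.span ℤ {x, y}) = ‖x‖ := by
  refine IsLeast.csInf_eq ⟨⟨x, Submodule.subset_span (by simp), h.2.1, rfl⟩, ?_⟩
  rintro _ ⟨v, hv, h0, rfl⟩
  exact h.norm_le hv h0

theorem minVectors_eq (h : IsReducedPair x y) :
    minVectors (Submodule.span ℤ {x, y}) = {x, -x, y, -y} := by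
  ext v
  simp only [minVectors, h.latticeMin_eq, Set.mem_ofPred_eq, Set.mem_insert_iff,
    Set.mem_singleton_iff]
  constructor
  · rintro ⟨hv, hn⟩
    exact h.eq_of_norm_le hv (norm_pos_iff.1 (hn ▸ h.norm_pos)) hn.le
  · have hx : x ∈ Submodule.span ℤ {x, y} := Submodule.subset_span (by simp)
    have hy : y ∈ Submodule.span ℤ {x, y} := Submodule.subset_span (by simp)
    rintro (rfl | rfl | rfl | rfl)
    · exact ⟨hx, rfl⟩
    · exact ⟨neg_mem hx, norm_neg _⟩
    · exact ⟨hy, h.1.symm⟩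
    · exact ⟨neg_mem hy, by rw [norm_neg, h.1]⟩

theorem isShortestBasis (h : IsReducedPair x y) : IsShortestBasis (Submodule.span ℤ {x, y}) x y := by
  refine ⟨?_, rfl, fun y' hy' => ?_⟩
  · rw [h.minVectors_eq]
    simp
  · rw [← h.1]
    refine h.norm_le (hy' ▸ Submodule.subset_span (by simp)) ?_
    rintro rfl
    have hy : y ∈ Submodule.span ℤ {x, 0} := hy' ▸ Submodule.subset_span (by simp)
    obtain ⟨i, j, hij⟩ := Submodule.mem_span_pair.1 hy
    have := (h.eq_zero_of_comb (i := i) (j := -1) (by rw [← hij]; simp)).2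
    omega

/-- Both vectors of a shortest basis are among `±x, ±y`, and they are not proportional since they
generate the lattice. Hence the basis is `x, y` up to signs and order. -/
theorem inner_of_isShortestBasis (h : IsReducedPair x y) {x' y' : EuclideanSpace ℝ (Fin 2)}
    (h' : IsShortestBasis (Submodule.span ℤ {x, y}) x' y') :
    ‖x'‖ = ‖x‖ ∧ ‖y'‖ = ‖x‖ ∧ |inner ℝ x' y'| = |inner ℝ x y| := by
  obtain ⟨hx', hs, hmin⟩ := h'
  have hx : x ∈ Submodule.span ℤ {x', y'} := hs ▸ Submodule.subset_span (by simp)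
  have hy : y ∈ Submodule.span ℤ {x', y'} := hs ▸ Submodule.subset_span (by simp)
  have hy' : y' ∈ Submodule.span ℤ {x, y} := hs ▸ Submodule.subset_span (by simp)
  have not_mul : ∀ a : ℤ, ∀ b : ℤ, a • x + b • y = 0 → b = 0 ∧ a = 0 := fun a b hab =>
    (h.eq_zero_of_comb hab).symm
  obtain ⟨i, j, hij⟩ := Submodule.mem_span_pair.1 hx
  obtain ⟨k, l, hkl⟩ := Submodule.mem_span_pair.1 hy
  rw [h.minVectors_eq] at hx'
  -- Whichever of `±x, ±y` the vector `x'` is, the other of `x, y` completes it to a basis and has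
  -- the same length.
  have hle : ‖y'‖ ≤ ‖x‖ := by
    rcases hx' with rfl | rfl | rfl | rfl
    · rw [h.1]
      exact hmin y rfl
    · rw [h.1]
      exact hmin y (span_pair_neg_left _ _)
    · exact hmin x (by rw [Set.pair_comm])
    · exact hmin x (by rw [span_pair_neg_left, Set.pair_comm])
  have hne : y' ≠ 0 := by
    rintro rfl
    simp only [smul_zero, add_zero] at hij hkl
    have h1 : k • x + (-i) • y = 0 := by
      rw [← hij, ← hkl]
      module
    obtain ⟨h2, h3⟩ := not_mul _ _ h1
    rw [h3, zero_smul] at hkl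
    exact h.symm.2.1 hkl.symm
  have hy'' := h.eq_of_norm_le hy' hne hle
  have bad : ∀ a : ℤ, a • x ≠ y := fun a ha => by
    have := (not_mul a (-1) (by rw [← ha]; module)).1
    omega
  have bad' : ∀ a : ℤ, a • y ≠ x := fun a ha => by
    have := (not_mul (-1) a (by rw [← ha]; module)).2
    omega
  rcases hx' with hx' | hx' | hx' | hx' <;> rcases hy'' with hy'' | hy'' | hy'' | hy''
  all_goals rw [hx', hy''] at hkl hij ⊢
  -- In eight of the sixteen cases `x', y'` are proportional, and then one of `x, y` would be a
  -- multiple of the other. In the remaining eight the claim is immediate.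
  all_goals first
    | exact absurd (show (k + l) • x = y by rw [← hkl]; module) (bad _)
    | exact absurd (show (k - l) • x = y by rw [← hkl]; module) (bad _)
    | exact absurd (show (l - k) • x = y by rw [← hkl]; module) (bad _)
    | exact absurd (show (-k - l) • x = y by rw [← hkl]; module) (bad _)
    | exact absurd (show (i + j) • y = x by rw [← hij]; module) (bad' _)
    | exact absurd (show (i - j) • y = x by rw [← hij]; module) (bad' _)
    | exact absurd (show (j - i) • y = x by rw [← hij]; module) (bad' _)
    | exact absurd (show (-i - j) • y = x by rw [← hij]; module) (bad' _)
    | simp [inner_neg_left, inner_neg_right, h.1, real_inner_comm]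

theorem latticeAngle_eq (h : IsReducedPair x y) : latticeAngle (Submodule.span ℤ {x, y}) =
    Real.arccos (|inner ℝ x y| / ‖x‖ ^ 2) := by
  have : {t : ℝ | ∃ x' y', IsShortestBasis (Submodule.span ℤ {x, y}) x' y' ∧
      t = Real.arccos (|inner ℝ x' y'| / (‖x'‖ * ‖y'‖))} =
        {Real.arccos (|inner ℝ x y| / ‖x‖ ^ 2)} := by
    ext t
    constructor
    · rintro ⟨x', y', h', rfl⟩
      obtain ⟨h1, h2, h3⟩ := h.inner_of_isShortestBasis h'
      rw [h1, h2, h3, ← pow_two]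
      rfl
    · rintro rfl
      exact ⟨x, y, h.isShortestBasis, by rw [← h.1, ← pow_two]⟩
  rw [latticeAngle, this, csInf_singleton]

theorem sin_latticeAngle (h : IsReducedPair x y) :
    Real.sin (latticeAngle (Submodule.span ℤ {x, y})) =
      √(1 - (inner ℝ x y / ‖x‖ ^ 2) ^ 2) := by
  rw [h.latticeAngle_eq, Real.sin_arccos, div_pow, div_pow, sq_abs]

/-- The strict angle condition makes the Gram form positive definite: `2|st||⟨x, y⟩| ≤ |st|‖x‖² ≤
(s² + t²)‖x‖²/2`. -/
theorem linearIndependent (h : IsReducedPair x y) : LinearIndependent ℝ ![x, y] := by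
  rw [LinearIndependent.pair_iff]
  intro s t hst
  have h1 := h.norm_sq_comb_real s t
  rw [hst, norm_zero] at h1
  have h2 := h.2.2
  have h3 := pow_pos h.norm_pos 2
  have h4 : -(|s * t| * |inner ℝ x y|) ≤ (s * t) * inner ℝ x y := by
    rw [← abs_mul]
    exact neg_abs_le _
  have h5 : 2 * |s * t| ≤ s ^ 2 + t ^ 2 := by
    rw [abs_mul]
    nlinarith [sq_nonneg (|s| - |t|), sq_abs s, sq_abs t]
  have h6 : |s * t| * (2 * |inner ℝ x y|) ≤ |s * t| * ‖x‖ ^ 2 :=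
    mul_le_mul_of_nonneg_left h2.le (abs_nonneg _)
  have h7 : (s ^ 2 + t ^ 2) * ‖x‖ ^ 2 ≤ 0 := by nlinarith
  have h8 : s ^ 2 + t ^ 2 ≤ 0 := by
    by_contra! hlt
    nlinarith [mul_pos hlt h3]
  constructor <;> nlinarith [sq_nonneg s, sq_nonneg t]

/-- The real basis given by a reduced pair. -/
noncomputable def basis (h : IsReducedPair x y) : Module.Basis (Fin 2) ℝ (EuclideanSpace ℝ (Fin 2)) :=
  basisOfLinearIndependentOfCardEqFinrank h.linearIndependent (by simp)

theorem coe_basis (h : IsReducedPair x y) : ⇑h.basis = ![x, y] :=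
  coe_basisOfLinearIndependentOfCardEqFinrank _ _

theorem span_real (h : IsReducedPair x y) : Submodule.span ℝ {x, y} = ⊤ := by
  rw [← h.basis.span_eq, h.coe_basis, Matrix.range_cons_cons_empty]

theorem mem_wrSublattices (h : IsReducedPair x y) {Ω : Submodule ℤ (EuclideanSpace ℝ (Fin 2))}
    (hx : x ∈ Ω) (hy : y ∈ Ω) : Submodule.span ℤ {x, y} ∈ wrSublattices Ω := by
  refine ⟨Submodule.span_le.2 ?_, ?_, ?_⟩
  · rintro z (rfl | rfl)
    · exact hx
    · exact hy
  · rw [eq_top_iff, ← h.span_real]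
    exact Submodule.span_mono Submodule.subset_span
  · rw [IsWellRounded, h.minVectors_eq, eq_top_iff, ← h.span_real]
    refine Submodule.span_mono ?_
    rintro z (rfl | rfl) <;> simp

theorem covolume_eq (h : IsReducedPair x y) :
    ZLattice.covolume (Submodule.span ℤ {x, y}) = |x 0 * y 1 - x 1 * y 0| := by
  have hr : ({x, y} : Set (EuclideanSpace ℝ (Fin 2))) = Set.range h.basis := by
    rw [h.coe_basis, Matrix.range_cons_cons_empty]
  rw [hr, ZLattice.covolume_eq_measure_fundamentalDomain _ _
    (ZSpan.isAddFundamentalDomain h.basis volume),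
    ZSpan.measureReal_fundamentalDomain h.basis volume (EuclideanSpace.basisFun (Fin 2) ℝ).toBasis]
  have h1 : volume.real (ZSpan.fundamentalDomain (EuclideanSpace.basisFun (Fin 2) ℝ).toBasis) = 1 := by
    rw [measureReal_congr (ZSpan.fundamentalDomain_ae_parallelepiped _ volume), Measure.real,
      OrthonormalBasis.coe_toBasis, OrthonormalBasis.volume_parallelepiped]
    rfl
  rw [h1, mul_one, Module.Basis.det_apply, Matrix.det_fin_two]
  simp [Module.Basis.toMatrix_apply, h.coe_basis]
  ring_nf

end IsReducedPair

/-! ### Well-rounded sublattices of `ℤ²` -/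

/-- An integer vector as a point of the Euclidean plane. -/
noncomputable def latPoint (v : ℤ × ℤ) : EuclideanSpace ℝ (Fin 2) := !₂[(v.1 : ℝ), (v.2 : ℝ)]

@[simp] theorem latPoint_zero (v : ℤ × ℤ) : latPoint v 0 = v.1 := rfl

@[simp] theorem latPoint_one (v : ℤ × ℤ) : latPoint v 1 = v.2 := rfl

theorem latPoint_injective : Function.Injective latPoint := fun v w h => by
  have h0 : latPoint v 0 = latPoint w 0 := by rw [h]
  have h1 : latPoint v 1 = latPoint w 1 := by rw [h]
  simp only [latPoint_zero, latPoint_one, Int.cast_inj] at h0 h1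
  exact Prod.ext h0 h1

theorem latPoint_neg (v : ℤ × ℤ) : latPoint (-v) = -latPoint v := by
  ext i
  fin_cases i <;> simp [latPoint]

theorem mem_intLattice_iff {z : EuclideanSpace ℝ (Fin 2)} :
    z ∈ intLattice 2 ↔ ∃ v, latPoint v = z := by
  rw [intLattice, ← OrthonormalBasis.coe_toBasis, Module.Basis.mem_span_iff_repr_mem]
  simp only [Fin.forall_fin_two]
  constructor
  · rintro ⟨⟨m, hm⟩, n, hn⟩
    refine ⟨(m, n), ?_⟩
    ext i
    fin_cases i
    · simpa using hm
    · simpa using hn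
  · rintro ⟨v, rfl⟩
    exact ⟨⟨v.1, by simp⟩, v.2, by simp⟩

theorem inner_latPoint (v w : ℤ × ℤ) :
    inner ℝ (latPoint v) (latPoint w) = ((v.1 * w.1 + v.2 * w.2 : ℤ) : ℝ) := by
  rw [PiLp.inner_apply, Fin.sum_univ_two]
  simp [mul_comm]

theorem norm_sq_latPoint (v : ℤ × ℤ) : ‖latPoint v‖ ^ 2 = ((v.1 ^ 2 + v.2 ^ 2 : ℤ) : ℝ) := by
  rw [← real_inner_self_eq_norm_sq, inner_latPoint]
  push_cast
  ring

theorem isReducedPair_latPoint_iff {v w : ℤ × ℤ} : IsReducedPair (latPoint v) (latPoint w) ↔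
    v.1 ^ 2 + v.2 ^ 2 = w.1 ^ 2 + w.2 ^ 2 ∧
      2 * |v.1 * w.1 + v.2 * w.2| < v.1 ^ 2 + v.2 ^ 2 := by
  rw [IsReducedPair, inner_latPoint, norm_sq_latPoint,
    ← pow_left_inj₀ (norm_nonneg _) (norm_nonneg _) two_ne_zero, norm_sq_latPoint, norm_sq_latPoint,
    Int.cast_inj, ← Int.cast_abs]
  norm_cast
  refine and_congr_right fun h => ⟨fun h => h.2, fun h => ⟨?_, h⟩⟩
  intro h0
  have h1 : latPoint v 0 = 0 := by rw [h0]; rfl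
  have h2 : latPoint v 1 = 0 := by rw [h0]; rfl
  simp only [latPoint_zero, latPoint_one, Int.cast_eq_zero] at h1 h2
  rw [h1, h2] at h
  have := abs_nonneg (0 * w.1 + 0 * w.2)
  linarith

/-- Irrationality of `√3`; it excludes hexagonal sublattices, which would have six minimal vectors.
-/
theorem eq_zero_of_sq_eq_three_mul_sq {a b : ℤ} (h : a ^ 2 = 3 * b ^ 2) : b = 0 := by
  by_contra hb
  have hb' : (b : ℝ) ≠ 0 := by exact_mod_cast hb
  refine Nat.prime_three.irrational_sqrt ⟨|(a : ℚ) / b|, ?_⟩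
  have h1 : (a : ℝ) ^ 2 = 3 * (b : ℝ) ^ 2 := by exact_mod_cast h
  have h2 : (((3 : ℕ) : ℝ)) = ((a : ℝ) / b) ^ 2 := by
    rw [div_pow, h1]
    field_simp
    norm_num
  rw [h2, Real.sqrt_sq_eq_abs]
  push_cast
  rfl

theorem detSq_add_innerSq {v w : ℤ × ℤ} (h : v.1 ^ 2 + v.2 ^ 2 = w.1 ^ 2 + w.2 ^ 2) :
    |v.1 * w.2 - v.2 * w.1| ^ 2 + (v.1 * w.1 + v.2 * w.2) ^ 2 = (v.1 ^ 2 + v.2 ^ 2) ^ 2 := by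
  rw [sq_abs]
  linear_combination -(v.1 ^ 2 + v.2 ^ 2) * h

theorem exists_minVectors_independent {L : Submodule ℤ (EuclideanSpace ℝ (Fin 2))}
    (hL : IsWellRounded L) : ∃ x ∈ minVectors L, ∃ y ∈ minVectors L,
      x ≠ 0 ∧ ∀ c : ℝ, c • x ≠ y := by
  have h1 : ∃ x ∈ minVectors L, x ≠ 0 := by
    by_contra! h
    have : Submodule.span ℝ (minVectors L) ≤ ⊥ := Submodule.span_le.2 fun x hx => h x hx
    rw [hL] at this
    exact bot_ne_top (top_le_iff.1 this)
  obtain ⟨x, hx, hx0⟩ := h1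
  refine ⟨x, hx, ?_⟩
  by_contra! h
  have h2 : Submodule.span ℝ (minVectors L) ≤ Submodule.span ℝ {x} :=
    Submodule.span_le.2 fun y hy => by
      obtain ⟨c, hc⟩ := h y hy hx0
      exact Submodule.mem_span_singleton.2 ⟨c, hc⟩
  rw [hL, top_le_iff] at h2
  have h3 := finrank_span_singleton (K := ℝ) hx0
  rw [h2, finrank_top] at h3
  simp at h3

theorem latticeMin_le {L : Submodule ℤ (EuclideanSpace ℝ (Fin 2))} {z : EuclideanSpace ℝ (Fin 2)}
    (hz : z ∈ L) (h0 : z ≠ 0) : latticeMin L ≤ ‖z‖ :=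
  csInf_le ⟨0, by
    rintro _ ⟨x, -, -, rfl⟩
    exact norm_nonneg x⟩ ⟨z, hz, h0, rfl⟩

/-- A well-rounded sublattice of `ℤ²` has a reduced basis. -/
theorem exists_reduced_basis {L : Submodule ℤ (EuclideanSpace ℝ (Fin 2))} (hL : L ∈ WRZ2) :
    ∃ v w, IsReducedPair (latPoint v) (latPoint w) ∧
      L = Submodule.span ℤ {latPoint v, latPoint w} := by
  obtain ⟨hle, -, hwr⟩ := hL
  obtain ⟨x, ⟨hxL, hxn⟩, y, ⟨hyL, hyn⟩, hx0, hxy⟩ := exists_minVectors_independent hwr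
  obtain ⟨v, rfl⟩ := mem_intLattice_iff.1 (hle hxL)
  obtain ⟨w, rfl⟩ := mem_intLattice_iff.1 (hle hyL)
  have hr : 0 ≤ latticeMin L := hxn ▸ norm_nonneg _
  -- The vectors `v ± w` are nonzero and in `L`, hence not shorter than the minimum; this gives
  -- `2|⟨v, w⟩| ≤ ‖v‖²`.
  have hadd : latticeMin L ^ 2 ≤ ‖latPoint v + latPoint w‖ ^ 2 :=
    pow_le_pow_left₀ hr (latticeMin_le (add_mem hxL hyL) fun h =>
      hxy (-1) (by rw [neg_one_smul]; exact neg_eq_of_add_eq_zero_right h)) 2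
  have hsub : latticeMin L ^ 2 ≤ ‖latPoint v - latPoint w‖ ^ 2 :=
    pow_le_pow_left₀ hr (latticeMin_le (sub_mem hxL hyL) fun h =>
      hxy 1 (by rw [one_smul]; exact sub_eq_zero.1 h)) 2
  rw [norm_add_sq_real, hyn, ← hxn, norm_sq_latPoint, inner_latPoint] at hadd
  rw [norm_sub_sq_real, hyn, ← hxn, norm_sq_latPoint, inner_latPoint] at hsub
  have hN : v.1 ^ 2 + v.2 ^ 2 = w.1 ^ 2 + w.2 ^ 2 := by
    have : ‖latPoint v‖ ^ 2 = ‖latPoint w‖ ^ 2 := by rw [hxn, hyn]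
    rw [norm_sq_latPoint, norm_sq_latPoint] at this
    exact_mod_cast this
  have hadd' : v.1 ^ 2 + v.2 ^ 2 ≤
      v.1 ^ 2 + v.2 ^ 2 + 2 * (v.1 * w.1 + v.2 * w.2) + (v.1 ^ 2 + v.2 ^ 2) := by
    exact_mod_cast hadd
  have hsub' : v.1 ^ 2 + v.2 ^ 2 ≤
      v.1 ^ 2 + v.2 ^ 2 - 2 * (v.1 * w.1 + v.2 * w.2) + (v.1 ^ 2 + v.2 ^ 2) := by
    exact_mod_cast hsub
  have hle2 : 2 * |v.1 * w.1 + v.2 * w.2| ≤ v.1 ^ 2 + v.2 ^ 2 := by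
    rcases abs_cases (v.1 * w.1 + v.2 * w.2) with ⟨h, -⟩ | ⟨h, -⟩ <;> rw [h] <;> linarith
  have hred : IsReducedPair (latPoint v) (latPoint w) := by
    -- Equality would give `(2 det)² = 3N²` with `N = ‖v‖²`, by the Lagrange identity.
    refine isReducedPair_latPoint_iff.2 ⟨hN, lt_of_le_of_ne hle2 fun heq => hx0 ?_⟩
    have h1 : (2 * (v.1 * w.1 + v.2 * w.2)) ^ 2 = (v.1 ^ 2 + v.2 ^ 2) ^ 2 := by
      rw [← heq, mul_pow, mul_pow, sq_abs]
    have h2 : v.1 ^ 2 + v.2 ^ 2 = 0 :=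
      eq_zero_of_sq_eq_three_mul_sq (a := 2 * (v.1 * w.2 - v.2 * w.1)) (by
        have h3 := detSq_add_innerSq hN
        rw [sq_abs] at h3
        linarith)
    have h4 := norm_sq_latPoint v
    rw [h2] at h4
    simpa using h4
  refine ⟨v, w, hred, le_antisymm (fun z hz => ?_) (Submodule.span_le.2 ?_)⟩
  · have hz' : z ∈ Submodule.span ℝ {latPoint v, latPoint w} := by
      rw [hred.span_real]
      trivial
    obtain ⟨s, t, rfl⟩ := Submodule.mem_span_pair.1 hz'
    rw [Submodule.mem_span_pair]
    -- After rounding, the remainder has coefficients at most `1/2` in absolute value, so its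
    -- squared norm is at most `N/2 + |⟨v, w⟩|/2 < 3N/4` with `N = ‖v‖²`. Being in `L` and shorter
    -- than the minimum, it is zero.
    refine ⟨round s, round t, ?_⟩
    by_contra hne
    have h1 : (s - round s) • latPoint v + (t - round t) • latPoint w =
        s • latPoint v + t • latPoint w - (round s • latPoint v + round t • latPoint w) := by
      rw [← Int.cast_smul_eq_zsmul ℝ, ← Int.cast_smul_eq_zsmul ℝ]
      module
    have h2 := pow_le_pow_left₀ hr (latticeMin_le
      (sub_mem hz (add_mem (zsmul_mem hxL (round s)) (zsmul_mem hyL (round t))))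
      (sub_ne_zero.2 (Ne.symm hne))) 2
    rw [← h1, hred.norm_sq_comb_real, ← hxn] at h2
    have hs := abs_sub_round s
    have ht := abs_sub_round t
    generalize s - round s = a at h2 hs
    generalize t - round t = b at h2 ht
    have h3 := hred.2.2
    have h4 := pow_pos hred.norm_pos 2
    have h5 : (a * b) * inner ℝ (latPoint v) (latPoint w) ≤
        |a| * |b| * |inner ℝ (latPoint v) (latPoint w)| := by
      rw [← abs_mul, ← abs_mul]
      exact le_abs_self _
    have h6 : |a| * |b| ≤ 1 / 4 := by nlinarith [abs_nonneg a, abs_nonneg b]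
    have h7 : a ^ 2 ≤ 1 / 4 := by rw [← sq_abs]; nlinarith [abs_nonneg a]
    have h8 : b ^ 2 ≤ 1 / 4 := by rw [← sq_abs]; nlinarith [abs_nonneg b]
    have h9 : |a| * |b| * |inner ℝ (latPoint v) (latPoint w)| ≤
        1 / 4 * |inner ℝ (latPoint v) (latPoint w)| :=
      mul_le_mul_of_nonneg_right h6 (abs_nonneg _)
    have h10 : (a ^ 2 + b ^ 2) * ‖latPoint v‖ ^ 2 ≤ 1 / 2 * ‖latPoint v‖ ^ 2 :=
      mul_le_mul_of_nonneg_right (by linarith) h4.le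
    nlinarith
  · rintro z (rfl | rfl)
    · exact hxL
    · exact hyL

theorem IsReducedPair.span_latPoint_mem {v w : ℤ × ℤ}
    (h : IsReducedPair (latPoint v) (latPoint w)) :
    Submodule.span ℤ {latPoint v, latPoint w} ∈ WRZ2 :=
  h.mem_wrSublattices (mem_intLattice_iff.2 ⟨v, rfl⟩) (mem_intLattice_iff.2 ⟨w, rfl⟩)

theorem IsReducedPair.sin_latPoint {v w : ℤ × ℤ} (h : IsReducedPair (latPoint v) (latPoint w)) :
    Real.sin (latticeAngle (Submodule.span ℤ {latPoint v, latPoint w})) =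
      ((|v.1 * w.2 - v.2 * w.1| : ℤ) : ℝ) / ((v.1 ^ 2 + v.2 ^ 2 : ℤ) : ℝ) := by
  have hN := (isReducedPair_latPoint_iff.1 h).1
  have hpos : (0 : ℝ) < ((v.1 ^ 2 + v.2 ^ 2 : ℤ) : ℝ) := by
    rw [← norm_sq_latPoint]
    exact pow_pos h.norm_pos 2
  have hD : ((|v.1 * w.2 - v.2 * w.1| : ℤ) : ℝ) ^ 2 + ((v.1 * w.1 + v.2 * w.2 : ℤ) : ℝ) ^ 2 =
      ((v.1 ^ 2 + v.2 ^ 2 : ℤ) : ℝ) ^ 2 := by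
    exact_mod_cast detSq_add_innerSq hN
  have hD0 : (0 : ℝ) ≤ ((|v.1 * w.2 - v.2 * w.1| : ℤ) : ℝ) := by exact_mod_cast abs_nonneg _
  rw [h.sin_latticeAngle, inner_latPoint, norm_sq_latPoint]
  rw [← Real.sqrt_sq (div_nonneg hD0 hpos.le)]
  congr 1
  rw [div_pow, div_pow]
  field_simp
  linarith

/-! ### Similarity classes and the fractions in `𝒮` -/

theorem exists_mem_fareyPairs {L : Submodule ℤ (EuclideanSpace ℝ (Fin 2))} (hL : L ∈ WRZ2) :
    ∃ p q : ℕ, (p, q) ∈ fareyPairs ∧ Real.sin (latticeAngle L) = (p : ℝ) / q := by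
  obtain ⟨v, w, h, rfl⟩ := exists_reduced_basis hL
  obtain ⟨hN, hc⟩ := isReducedPair_latPoint_iff.1 h
  rw [h.sin_latPoint]
  have hD := detSq_add_innerSq hN
  have hc' : 4 * (v.1 * w.1 + v.2 * w.2) ^ 2 < (v.1 ^ 2 + v.2 ^ 2) ^ 2 := by
    rw [← sq_abs (v.1 * w.1 + v.2 * w.2)]
    nlinarith [abs_nonneg (v.1 * w.1 + v.2 * w.2)]
  have hN0 : 0 < v.1 ^ 2 + v.2 ^ 2 := by linarith [abs_nonneg (v.1 * w.1 + v.2 * w.2)]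
  have hD0 := abs_nonneg (v.1 * w.2 - v.2 * w.1)
  clear hN hc h hL
  generalize |v.1 * w.2 - v.2 * w.1| = D at *
  generalize v.1 * w.1 + v.2 * w.2 = c at *
  generalize v.1 ^ 2 + v.2 ^ 2 = N at *
  have hg : 0 < Int.gcd D N := Int.gcd_pos_iff.2 (Or.inr hN0.ne')
  obtain ⟨p, q, hpq, hp, hq⟩ := Int.exists_gcd_one hg
  generalize Int.gcd D N = g at *
  have hg' : (0 : ℤ) < g := by exact_mod_cast hg
  -- `D² + c² = N²` and `g` divides `D` and `N`, so `g² ∣ c²`. Thus the inner product scales down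
  -- along with `D` and `N`, which provides the third side `t`.
  have hgc : (g : ℤ) ∣ c := by
    rw [← Int.pow_dvd_pow_iff two_ne_zero]
    refine ⟨q ^ 2 - p ^ 2, ?_⟩
    rw [hp, hq] at hD
    linear_combination hD
  obtain ⟨t, rfl⟩ := hgc
  have hg2 : (0 : ℤ) < (g : ℤ) ^ 2 := by positivity
  have hq0 : 0 < q := pos_of_mul_pos_left (hq ▸ hN0) hg'.le
  have hp0 : 0 ≤ p := nonneg_of_mul_nonneg_left (hp ▸ hD0) hg'
  have ht : t ^ 2 + p ^ 2 = q ^ 2 := by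
    refine mul_left_cancel₀ hg2.ne' ?_
    rw [hp, hq] at hD
    linear_combination hD
  have h3 : 3 * q ^ 2 < 4 * p ^ 2 := by
    refine lt_of_mul_lt_mul_left (a := (g : ℤ) ^ 2) ?_ hg2.le
    rw [hq] at hc'
    nlinarith
  have hp1 : 0 < p := lt_of_le_of_ne hp0 (by rintro rfl; nlinarith)
  refine ⟨p.toNat, q.toNat, mem_fareyPairs_iff.2 ?_, ?_⟩
  · rw [Int.toNat_of_nonneg hp0, Int.toNat_of_nonneg hq0.le]
    refine ⟨by omega, Int.toNat_le_toNat ?_, Int.isCoprime_iff_gcd_eq_one.2 hpq, h3, t.natAbs, ?_⟩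
    · nlinarith [sq_nonneg t]
    · rw [Int.natAbs_sq]
      exact ht
  · have e1 : ((p.toNat : ℤ) : ℝ) = p := by rw [Int.toNat_of_nonneg hp0]
    have e2 : ((q.toNat : ℤ) : ℝ) = q := by rw [Int.toNat_of_nonneg hq0.le]
    rw [Int.cast_natCast] at e1 e2
    rw [e1, e2, hp, hq]
    push_cast
    have : (g : ℝ) ≠ 0 := by positivity
    rw [mul_div_mul_right _ _ this]

theorem classOf_nonempty {p q : ℕ} (h : (p, q) ∈ fareyPairs) : (classOf p q).Nonempty := by
  obtain ⟨hp, hle, hcop, h3, t, ht⟩ := mem_fareyPairs_iff.1 h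
  have hq : (0 : ℤ) < q := by exact_mod_cast hp.trans_le hle
  -- The vectors `(q, 0)` and `(t, p)` both have length `q` and determinant `qp`, so the sine is
  -- `p/q`.
  have hred : IsReducedPair (latPoint (q, 0)) (latPoint (t, p)) := by
    rw [isReducedPair_latPoint_iff]
    refine ⟨by simpa using ht.symm, ?_⟩
    have h0 : (0 : ℤ) ≤ q * t := by positivity
    simp only [zero_mul, add_zero, abs_of_nonneg h0]
    have : 2 * (t : ℤ) < q := by nlinarith
    nlinarith
  refine ⟨_, hred.span_latPoint_mem, ?_⟩
  rw [hred.sin_latPoint]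
  have h0 : (0 : ℤ) ≤ q * p := by positivity
  have hq' : (q : ℝ) ≠ 0 := by
    have : (0 : ℝ) < q := by exact_mod_cast hq
    exact this.ne'
  simp only [zero_mul, sub_zero, abs_of_nonneg h0]
  push_cast
  field_simp
  ring

/-- Under the hypothesis the Gram matrices are proportional, so the linear map taking one basis to
the other multiplies all norms by `α = ‖x'‖/‖x‖`. -/
theorem IsReducedPair.latticeSimilar {x y x' y' : EuclideanSpace ℝ (Fin 2)}
    (h : IsReducedPair x y) (h' : IsReducedPair x' y')
    (e : inner ℝ x' y' / ‖x'‖ ^ 2 = inner ℝ x y / ‖x‖ ^ 2) :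
    LatticeSimilar (Submodule.span ℤ {x', y'}) (Submodule.span ℤ {x, y}) := by
  have hx := h.norm_pos
  have hx' := h'.norm_pos
  set α := ‖x'‖ / ‖x‖ with hα
  have hα0 : 0 < α := div_pos hx' hx
  let f : EuclideanSpace ℝ (Fin 2) ≃ₗ[ℝ] EuclideanSpace ℝ (Fin 2) :=
    h.basis.equiv h'.basis (Equiv.refl _)
  have hfx : f x = x' := by
    have := h.basis.equiv_apply 0 h'.basis (Equiv.refl _)
    simpa [h.coe_basis, h'.coe_basis] using this
  have hfy : f y = y' := by
    have := h.basis.equiv_apply 1 h'.basis (Equiv.refl _)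
    simpa [h.coe_basis, h'.coe_basis] using this
  have hnorm : ∀ z, ‖f z‖ = α * ‖z‖ := fun z => by
    have hz : z ∈ Submodule.span ℝ {x, y} := by
      rw [h.span_real]
      trivial
    obtain ⟨s, t, rfl⟩ := Submodule.mem_span_pair.1 hz
    rw [← pow_left_inj₀ (norm_nonneg _) (by positivity) two_ne_zero, mul_pow, map_add, map_smul,
      map_smul, hfx, hfy, h.norm_sq_comb_real, h'.norm_sq_comb_real]
    have e' : inner ℝ x' y' = α ^ 2 * inner ℝ x y := by
      rw [hα, div_pow]
      field_simp at e ⊢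
      linarith
    have e2 : ‖x'‖ ^ 2 = α ^ 2 * ‖x‖ ^ 2 := by
      rw [hα, div_pow]
      field_simp
    rw [e', e2]
    ring
  let U : EuclideanSpace ℝ (Fin 2) ≃ₗᵢ[ℝ] EuclideanSpace ℝ (Fin 2) :=
    { f.trans (LinearEquiv.smulOfNeZero ℝ _ α⁻¹ (inv_ne_zero hα0.ne')) with
      norm_map' := fun z => by
        change ‖α⁻¹ • f z‖ = ‖z‖
        rw [norm_smul, hnorm, Real.norm_of_nonneg (inv_nonneg.2 hα0.le),
          inv_mul_cancel_left₀ hα0.ne'] }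
  have hU : (fun z => α • U z) = f := by
    funext z
    change α • α⁻¹ • f z = f z
    rw [smul_inv_smul₀ hα0.ne']
  refine ⟨α, U, hα0, ?_⟩
  rw [hU]
  have := Submodule.map_span (f.toLinearMap.restrictScalars ℤ) {x, y}
  rw [Set.image_pair] at this
  simp only [LinearMap.coe_restrictScalars, LinearEquiv.coe_coe, hfx, hfy] at this
  rw [← this]
  rfl

theorem IsReducedPair.sin_eq_of_latticeSimilar {x y : EuclideanSpace ℝ (Fin 2)}
    (h : IsReducedPair x y) {L : Submodule ℤ (EuclideanSpace ℝ (Fin 2))}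
    (hL : LatticeSimilar L (Submodule.span ℤ {x, y})) :
    Real.sin (latticeAngle L) = Real.sin (latticeAngle (Submodule.span ℤ {x, y})) := by
  obtain ⟨α, U, hα, hL⟩ := hL
  have hn : ∀ z, ‖α • U z‖ = α * ‖z‖ := fun z => by
    rw [norm_smul, U.norm_map, Real.norm_of_nonneg hα.le]
  have hi : inner ℝ (α • U x) (α • U y) = α ^ 2 * inner ℝ x y := by
    rw [inner_smul_left, inner_smul_right, U.inner_map_map]
    simp
    ring
  have h' : IsReducedPair (α • U x) (α • U y) := by
    refine ⟨by rw [hn, hn, h.1], ?_, ?_⟩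
    · rw [← norm_pos_iff, hn]
      exact mul_pos hα h.norm_pos
    · rw [hi, hn, mul_pow, abs_mul, abs_of_pos (pow_pos hα 2), mul_left_comm]
      exact mul_lt_mul_of_pos_left h.2.2 (pow_pos hα 2)
  have hL' : L = Submodule.span ℤ {α • U x, α • U y} := by
    have := Submodule.map_span ((α • U.toLinearEquiv.toLinearMap).restrictScalars ℤ) {x, y}
    rw [Set.image_pair] at this
    refine SetLike.coe_injective ?_
    rw [hL]
    exact congrArg SetLike.coe this
  rw [hL', h.sin_latticeAngle, h'.sin_latticeAngle, hi, hn, mul_pow,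
    mul_div_mul_left _ _ (pow_pos hα 2).ne']

/-- The sine fixes the cosine between the basis vectors up to sign, and the sign can be changed by
replacing `y'` with `-y'`, which spans the same lattice with `x'`. -/
theorem latticeSimilar_iff {L L' : Submodule ℤ (EuclideanSpace ℝ (Fin 2))} (hL : L ∈ WRZ2)
    (hL' : L' ∈ WRZ2) :
    LatticeSimilar L' L ↔ Real.sin (latticeAngle L') = Real.sin (latticeAngle L) := by
  obtain ⟨v, w, h, rfl⟩ := exists_reduced_basis hL
  obtain ⟨v', w', h', rfl⟩ := exists_reduced_basis hL'
  refine ⟨h.sin_eq_of_latticeSimilar, fun e => ?_⟩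
  rw [h.sin_latticeAngle, h'.sin_latticeAngle] at e
  generalize latPoint v = x at *
  generalize latPoint w = y at *
  generalize latPoint v' = x' at *
  generalize latPoint w' = y' at *
  have bound : ∀ {x y : EuclideanSpace ℝ (Fin 2)}, IsReducedPair x y →
      0 ≤ 1 - (inner ℝ x y / ‖x‖ ^ 2) ^ 2 := fun {x y} h => by
    have h1 := pow_pos h.norm_pos 2
    have h2 : |inner ℝ x y / ‖x‖ ^ 2| ≤ 1 := by
      rw [abs_div, abs_of_pos h1, div_le_one h1]
      linarith [h.2.2, abs_nonneg (inner ℝ x y)]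
    have := (sq_le_one_iff_abs_le_one _).2 h2
    linarith
  rw [Real.sqrt_inj (bound h') (bound h)] at e
  have e2 : (inner ℝ x' y' / ‖x'‖ ^ 2) ^ 2 = (inner ℝ x y / ‖x‖ ^ 2) ^ 2 := by linarith
  rcases sq_eq_sq_iff_eq_or_eq_neg.1 e2 with e3 | e3
  · exact h.latticeSimilar h' e3
  · rw [← span_pair_neg_right x' y']
    refine h.latticeSimilar h'.neg_right ?_
    rw [inner_neg_right, neg_div, e3, neg_neg]

/-- The classes are nonempty, so a common member gives equal fractions; this makes both weights well
defined. -/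
theorem eq_of_classOf_eq {p q p' q' : ℕ} (h : (p, q) ∈ fareyPairs) (h' : (p', q') ∈ fareyPairs)
    (e : classOf p q = classOf p' q') : p = p' ∧ q = q' := by
  obtain ⟨L, hL⟩ := classOf_nonempty h
  have h2 : L ∈ classOf p' q' := e ▸ hL
  have h3 : (p : ℝ) / q = (p' : ℝ) / q' := hL.2.symm.trans h2.2
  obtain ⟨hp, hle, hc, -⟩ := mem_fareyPairs_iff.1 h
  obtain ⟨hp', hle', hc', -⟩ := mem_fareyPairs_iff.1 h'
  have hq : (q : ℝ) ≠ 0 := by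
    have := hp.trans_le hle
    positivity
  have hq' : (q' : ℝ) ≠ 0 := by
    have := hp'.trans_le hle'
    positivity
  rw [div_eq_div_iff hq hq'] at h3
  have h4 : (p : ℤ) * q' = p' * q := by exact_mod_cast h3
  have := eq_of_mul_eq_mul_of_isCoprime (by exact_mod_cast hp) (by exact_mod_cast hp') hc hc' h4
  exact_mod_cast this

theorem classOf_mem_simClasses {p q : ℕ} (h : (p, q) ∈ fareyPairs) : classOf p q ∈ simClasses := by
  obtain ⟨L, hL⟩ := classOf_nonempty h
  refine ⟨L, hL.1, Set.ext fun L' => and_congr_right fun hL' => ?_⟩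
  rw [latticeSimilar_iff hL.1 hL', hL.2]

theorem exists_eq_classOf {C : Set (Submodule ℤ (EuclideanSpace ℝ (Fin 2)))} (hC : C ∈ simClasses) :
    ∃ p q, (p, q) ∈ fareyPairs ∧ C = classOf p q := by
  obtain ⟨L, hL, rfl⟩ := hC
  obtain ⟨p, q, hpq, hs⟩ := exists_mem_fareyPairs hL
  refine ⟨p, q, hpq, Set.ext fun L' => and_congr_right fun hL' => ?_⟩
  rw [latticeSimilar_iff hL hL', hs]

theorem detWeight_classOf {p q : ℕ} (h : (p, q) ∈ fareyPairs) : detWeight (classOf p q) = p := by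
  have : {p' | ∃ q', (p', q') ∈ fareyPairs ∧ classOf p q = classOf p' q'} = {p} := by
    ext p'
    constructor
    · rintro ⟨q', h', e⟩
      exact (eq_of_classOf_eq h h' e).1.symm
    · rintro rfl
      exact ⟨q, h, rfl⟩
  rw [detWeight, this, csInf_singleton]

theorem minWeight_classOf {p q : ℕ} (h : (p, q) ∈ fareyPairs) : minWeight (classOf p q) = q := by
  have : {q' | ∃ p', (p', q') ∈ fareyPairs ∧ classOf p q = classOf p' q'} = {q} := by
    ext q'
    constructor
    · rintro ⟨p', h', e⟩
      exact (eq_of_classOf_eq h h' e).2.symm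
    · rintro rfl
      exact ⟨p, h, rfl⟩
  rw [minWeight, this, csInf_singleton]

/-- The class `C(p, q)` as an element of the set of similarity classes. -/
def fareyClass (z : fareyPairs) : simClasses := ⟨classOf z.1.1 z.1.2, classOf_mem_simClasses z.2⟩

theorem fareyClass_bijective : Function.Bijective fareyClass := by
  constructor
  · rintro ⟨⟨p, q⟩, h⟩ ⟨⟨p', q'⟩, h'⟩ e
    obtain ⟨h1, h2⟩ := eq_of_classOf_eq h h' (Subtype.ext_iff.1 e)
    exact Subtype.ext (Prod.ext h1 h2)
  · rintro ⟨C, hC⟩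
    obtain ⟨p, q, h, rfl⟩ := exists_eq_classOf hC
    exact ⟨⟨(p, q), h⟩, rfl⟩

theorem exists_dirPole_classDet : ∃ l : ℝ, 0 < l ∧ DirPole classDet 1 l := by
  obtain ⟨l, hl, h⟩ := exists_dirPole_fareyPairs_fst
  refine ⟨l, hl, h.of_bijective fareyClass_bijective fun z => ?_⟩
  rw [classDet, fareyClass, detWeight_classOf z.2]

theorem exists_dirPole_classMin : ∃ l : ℝ, 0 < l ∧ DirPole classMin 1 l := by
  obtain ⟨l, hl, h⟩ := exists_dirPole_fareyPairs_snd
  refine ⟨l, hl, h.of_bijective fareyClass_bijective fun z => ?_⟩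
  rw [classMin, fareyClass, minWeight_classOf z.2]

theorem exists_nat_classDet (C : simClasses) : ∃ n : ℕ, 0 < n ∧ classDet C = n := by
  obtain ⟨⟨⟨p, q⟩, h⟩, rfl⟩ := fareyClass_bijective.2 C
  exact ⟨p, (mem_fareyPairs_iff.1 h).1, by rw [classDet, fareyClass, detWeight_classOf h]⟩

theorem exists_nat_classMin (C : simClasses) : ∃ n : ℕ, 0 < n ∧ classMin C = n := by
  obtain ⟨⟨⟨p, q⟩, h⟩, rfl⟩ := fareyClass_bijective.2 C
  obtain ⟨hp, hle, -⟩ := mem_fareyPairs_iff.1 h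
  exact ⟨q, hp.trans_le hle, by rw [classMin, fareyClass, minWeight_classOf h]⟩

/-! ### Diagonal coordinates on `WR(ℤ²)` -/

/-- A primitive vector `(m, n)` in the quadrant and a vector `(a, b)` in the sector such that
`(a (m, n) ± b (-n, m)) / 2` are integral. -/
def RhombicData : Type :=
  {z : (ℤ × ℤ) × (ℤ × ℤ) // (intPoint z.1 ∈ quadrant ∧ Int.gcd z.1.1 z.1.2 = 1) ∧
    intPoint z.2 ∈ sector ∧ Even (z.2.1 * z.1.1 - z.2.2 * z.1.2) ∧
      Even (z.2.1 * z.1.2 + z.2.2 * z.1.1)}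

/-- The integer vectors `v, w` have sum `a (m, n)` and difference `b (-n, m)`. -/
def IsRhombic (v w : ℤ × ℤ) (m n a b : ℤ) : Prop :=
  (v.1 + w.1 = a * m ∧ v.2 + w.2 = a * n) ∧ v.1 - w.1 = -(b * n) ∧ v.2 - w.2 = b * m

namespace IsRhombic

variable {v w : ℤ × ℤ} {m n a b : ℤ}

theorem norm_left (h : IsRhombic v w m n a b) :
    4 * (v.1 ^ 2 + v.2 ^ 2) = (a ^ 2 + b ^ 2) * (m ^ 2 + n ^ 2) := by
  obtain ⟨⟨h1, h2⟩, h3, h4⟩ := h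
  have e1 : 2 * v.1 = a * m - b * n := by linarith
  have e2 : 2 * v.2 = a * n + b * m := by linarith
  have : 4 * (v.1 ^ 2 + v.2 ^ 2) = (2 * v.1) ^ 2 + (2 * v.2) ^ 2 := by ring
  rw [this, e1, e2]
  ring

theorem norm_right (h : IsRhombic v w m n a b) :
    4 * (w.1 ^ 2 + w.2 ^ 2) = (a ^ 2 + b ^ 2) * (m ^ 2 + n ^ 2) := by
  obtain ⟨⟨h1, h2⟩, h3, h4⟩ := h
  have e1 : 2 * w.1 = a * m + b * n := by linarith
  have e2 : 2 * w.2 = a * n - b * m := by linarith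
  have : 4 * (w.1 ^ 2 + w.2 ^ 2) = (2 * w.1) ^ 2 + (2 * w.2) ^ 2 := by ring
  rw [this, e1, e2]
  ring

theorem inner_eq (h : IsRhombic v w m n a b) :
    4 * (v.1 * w.1 + v.2 * w.2) = (a ^ 2 - b ^ 2) * (m ^ 2 + n ^ 2) := by
  obtain ⟨⟨h1, h2⟩, h3, h4⟩ := h
  have : 4 * (v.1 * w.1 + v.2 * w.2) =
      (v.1 + w.1) ^ 2 + (v.2 + w.2) ^ 2 - (v.1 - w.1) ^ 2 - (v.2 - w.2) ^ 2 := by ring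
  rw [this, h1, h2, h3, h4]
  ring

theorem det_eq (h : IsRhombic v w m n a b) :
    2 * (v.1 * w.2 - v.2 * w.1) = -(a * b * (m ^ 2 + n ^ 2)) := by
  obtain ⟨⟨h1, h2⟩, h3, h4⟩ := h
  have : 2 * (v.1 * w.2 - v.2 * w.1) =
      (v.2 + w.2) * (v.1 - w.1) - (v.1 + w.1) * (v.2 - w.2) := by ring
  rw [this, h1, h2, h3, h4]
  ring

/-- The squared norms are `(a² + b²)(m² + n²)/4` and the inner product is `(a² - b²)(m² + n²)/4`, so
the condition reads `2|a² - b²| < a² + b²`. -/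
theorem isReducedPair_iff (h : IsRhombic v w m n a b) (hmn : m ≠ 0 ∨ n ≠ 0) :
    IsReducedPair (latPoint v) (latPoint w) ↔ a ^ 2 < 3 * b ^ 2 ∧ b ^ 2 < 3 * a ^ 2 := by
  have hM : 0 < m ^ 2 + n ^ 2 := by
    rcases hmn with h | h <;> positivity
  have h1 := h.norm_left
  have h2 := h.norm_right
  have h3 := h.inner_eq
  rw [isReducedPair_latPoint_iff]
  have h4 : v.1 ^ 2 + v.2 ^ 2 = w.1 ^ 2 + w.2 ^ 2 := by linarith
  simp only [h4, true_and]
  have h5 : 4 * |v.1 * w.1 + v.2 * w.2| = |a ^ 2 - b ^ 2| * (m ^ 2 + n ^ 2) := by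
    have := congrArg abs h3
    rwa [abs_mul, abs_mul, abs_of_pos hM, abs_of_pos (by norm_num : (0 : ℤ) < 4)] at this
  have h6 : 2 * |v.1 * w.1 + v.2 * w.2| < w.1 ^ 2 + w.2 ^ 2 ↔
      (2 * |a ^ 2 - b ^ 2|) * (m ^ 2 + n ^ 2) < (a ^ 2 + b ^ 2) * (m ^ 2 + n ^ 2) := by
    constructor <;> intro h <;> linarith
  rw [h6, mul_lt_mul_iff_left₀ hM]
  constructor
  · intro h7
    have := le_abs_self (a ^ 2 - b ^ 2)
    have := neg_abs_le (a ^ 2 - b ^ 2)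
    constructor <;> linarith
  · rintro ⟨h7, h8⟩
    rcases abs_cases (a ^ 2 - b ^ 2) with ⟨h, -⟩ | ⟨h, -⟩ <;> rw [h] <;> linarith

end IsRhombic

namespace RhombicData

/-- The first basis vector. -/
def fst (z : RhombicData) : ℤ × ℤ :=
  ((z.1.2.1 * z.1.1.1 - z.1.2.2 * z.1.1.2) / 2, (z.1.2.1 * z.1.1.2 + z.1.2.2 * z.1.1.1) / 2)

/-- The second basis vector. -/
def snd (z : RhombicData) : ℤ × ℤ :=
  ((z.1.2.1 * z.1.1.1 + z.1.2.2 * z.1.1.2) / 2, (z.1.2.1 * z.1.1.2 - z.1.2.2 * z.1.1.1) / 2)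

theorem isRhombic (z : RhombicData) :
    IsRhombic z.fst z.snd z.1.1.1 z.1.1.2 z.1.2.1 z.1.2.2 := by
  obtain ⟨⟨⟨m, n⟩, a, b⟩, -, -, ⟨k, hk⟩, l, hl⟩ := z
  simp only [IsRhombic, fst, snd] at hk hl ⊢
  generalize a * m = A at *
  generalize b * n = B at *
  generalize a * n = C at *
  generalize b * m = D at *
  omega

theorem pos (z : RhombicData) : (0 < z.1.1.1 ∧ 0 ≤ z.1.1.2) ∧ 0 < z.1.2.1 ∧ 0 < z.1.2.2 :=
  ⟨intPoint_mem_quadrant.1 z.2.1.1, (intPoint_mem_sector.1 z.2.2.1).1,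
    (intPoint_mem_sector.1 z.2.2.1).2.1⟩

theorem isReducedPair (z : RhombicData) : IsReducedPair (latPoint z.fst) (latPoint z.snd) :=
  (z.isRhombic.isReducedPair_iff (Or.inl z.pos.1.1.ne')).2 (intPoint_mem_sector.1 z.2.2.1).2.2

/-- The lattice spanned by the two basis vectors. -/
noncomputable def lattice (z : RhombicData) : WRZ2 :=
  ⟨Submodule.span ℤ {latPoint z.fst, latPoint z.snd}, z.isReducedPair.span_latPoint_mem⟩

/-- The minimal vectors determine `v, w` up to signs and order, hence the diagonals up to sign and
exchange. The half-open quadrant for `(m, n)` and the positivity of `a, b` select exactly one of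
these choices. -/
theorem lattice_injective : Function.Injective lattice := by
  intro z z' h
  have hspan : Submodule.span ℤ {latPoint z.fst, latPoint z.snd} =
      Submodule.span ℤ {latPoint z'.fst, latPoint z'.snd} := Subtype.ext_iff.1 h
  have hmin := congrArg minVectors hspan
  rw [z.isReducedPair.minVectors_eq, z'.isReducedPair.minVectors_eq] at hmin
  have hv : latPoint z.fst ∈ ({latPoint z'.fst, -latPoint z'.fst, latPoint z'.snd,
      -latPoint z'.snd} : Set _) := hmin ▸ by simp
  have hw : latPoint z.snd ∈ ({latPoint z'.fst, -latPoint z'.fst, latPoint z'.snd,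
      -latPoint z'.snd} : Set _) := hmin ▸ by simp
  simp only [Set.mem_insert_iff, Set.mem_singleton_iff, ← latPoint_neg,
    latPoint_injective.eq_iff] at hv hw
  obtain ⟨⟨h1, h2⟩, h3, h4⟩ := z.isRhombic
  obtain ⟨⟨h1', h2'⟩, h3', h4'⟩ := z'.isRhombic
  obtain ⟨⟨hm, hn⟩, ha, hb⟩ := z.pos
  obtain ⟨⟨hm', hn'⟩, ha', hb'⟩ := z'.pos
  have hc := Int.isCoprime_iff_gcd_eq_one.2 z.2.1.2
  have hc' := Int.isCoprime_iff_gcd_eq_one.2 z'.2.1.2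
  generalize z.fst = v at *
  generalize z.snd = w at *
  generalize z'.fst = v' at *
  generalize z'.snd = w' at *
  obtain ⟨⟨⟨m, n⟩, a, b⟩, _⟩ := z
  obtain ⟨⟨⟨m', n'⟩, a', b'⟩, _⟩ := z'
  obtain ⟨v1, v2⟩ := v
  obtain ⟨w1, w2⟩ := w
  obtain ⟨v1', v2'⟩ := v'
  obtain ⟨w1', w2'⟩ := w'
  simp only [Prod.ext_iff, Prod.fst_neg, Prod.snd_neg] at *
  -- Once the products are abstracted, everything is linear: finitely many sign and order cases,
  -- excluded by the signs except for the identity.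
  have key : a * m = a' * m' ∧ a * n = a' * n' ∧ b * m = b' * m' := by
    have p1 := mul_pos ha hm
    have p2 := mul_nonneg ha.le hn
    have p3 := mul_nonneg hb.le hn
    have p4 := mul_pos hb hm
    have p1' := mul_pos ha' hm'
    have p2' := mul_nonneg ha'.le hn'
    have p3' := mul_nonneg hb'.le hn'
    have p4' := mul_pos hb' hm'
    clear hm hn ha hb hm' hn' ha' hb' hc hc' hspan hmin h
    generalize a * m = A at *
    generalize b * n = B at *
    generalize a * n = C at *
    generalize b * m = D at *
    generalize a' * m' = A' at *
    generalize b' * n' = B' at *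
    generalize a' * n' = C' at *
    generalize b' * m' = D' at *
    omega
  obtain ⟨k1, k2, k3⟩ := key
  have e : m * n' = m' * n := by
    refine mul_left_cancel₀ (mul_pos ha ha').ne' ?_
    linear_combination (a' * n') * k1 - (a' * m') * k2
  obtain ⟨rfl, rfl⟩ := eq_of_mul_eq_mul_of_isCoprime hm hm' hc hc' e
  obtain rfl := mul_right_cancel₀ hm.ne' k1
  obtain rfl := mul_right_cancel₀ hm.ne' k3
  rfl

theorem exists_lattice_eq_of_pos {v w : ℤ × ℤ} {m n a b : ℤ}
    (hred : IsReducedPair (latPoint v) (latPoint w)) (h : IsRhombic v w m n a b)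
    (hg : Int.gcd m n = 1) (hm : 0 < m) (hn : 0 ≤ n) (ha : 0 < a) (hb : 0 < b) :
    ∃ z : RhombicData, (z.lattice : Submodule ℤ _) = Submodule.span ℤ {latPoint v, latPoint w} := by
  obtain ⟨h1, h2⟩ := (h.isReducedPair_iff (Or.inl hm.ne')).1 hred
  obtain ⟨⟨k1, k2⟩, k3, k4⟩ := h
  let z : RhombicData := ⟨((m, n), (a, b)), ⟨intPoint_mem_quadrant.2 ⟨hm, hn⟩, hg⟩,
    intPoint_mem_sector.2 ⟨ha, hb, h1, h2⟩, ⟨v.1, by simp only; linarith⟩,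
    ⟨v.2, by simp only; linarith⟩⟩
  have hfst : z.fst = v := by
    refine Prod.ext ?_ ?_ <;> simp only [fst, z] <;> omega
  have hsnd : z.snd = w := by
    refine Prod.ext ?_ ?_ <;> simp only [snd, z] <;> omega
  exact ⟨z, by rw [← hfst, ← hsnd]; rfl⟩

theorem exists_lattice_eq_of_quadrant {v w : ℤ × ℤ} {m n a b : ℤ}
    (hred : IsReducedPair (latPoint v) (latPoint w)) (h : IsRhombic v w m n a b)
    (hg : Int.gcd m n = 1) (hm : 0 < m) (hn : 0 ≤ n) (ha : a ≠ 0) (hb : b ≠ 0) :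
    ∃ z : RhombicData, (z.lattice : Submodule ℤ _) = Submodule.span ℤ {latPoint v, latPoint w} := by
  have hpos : ∀ {v w : ℤ × ℤ} {a : ℤ}, IsReducedPair (latPoint v) (latPoint w) →
      IsRhombic v w m n a b → 0 < a →
      ∃ z : RhombicData, (z.lattice : Submodule ℤ _) =
        Submodule.span ℤ {latPoint v, latPoint w} := fun {v w a} hred h ha => by
    rcases lt_or_gt_of_ne hb with hb | hb
    · rw [Set.pair_comm]
      refine exists_lattice_eq_of_pos (a := a) (b := -b) hred.symm ?_ hg hm hn ha (by omega)
      obtain ⟨⟨h1, h2⟩, h3, h4⟩ := h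
      exact ⟨⟨by linarith, by linarith⟩, by linarith, by linarith⟩
    · exact exists_lattice_eq_of_pos hred h hg hm hn ha hb
  rcases lt_or_gt_of_ne ha with ha | ha
  · have hred' : IsReducedPair (latPoint (-w)) (latPoint (-v)) := by
      rw [isReducedPair_latPoint_iff] at hred ⊢
      simp only [Prod.fst_neg, Prod.snd_neg, neg_sq, neg_mul_neg]
      rw [mul_comm w.1, mul_comm w.2, ← hred.1]
      exact ⟨rfl, hred.2⟩
    obtain ⟨⟨h1, h2⟩, h3, h4⟩ := h
    have := hpos (a := -a) hred' ⟨⟨by simp; linarith, by simp; linarith⟩, by simp; linarith,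
      by simp; linarith⟩ (by omega)
    rwa [latPoint_neg, latPoint_neg, span_pair_neg_left, span_pair_neg_right, Set.pair_comm] at this
  · exact hpos hred h ha

/-- Replacing `w` by `-w` exchanges the diagonals and turns `(m, n)` by a right angle without
changing the lattice. At most three turns bring `(m, n)` into the half-open quadrant; the signs of
`a` and `b` are then corrected by swapping or negating `v, w`. -/
theorem exists_lattice_eq {v w : ℤ × ℤ} {m n a b : ℤ}
    (hred : IsReducedPair (latPoint v) (latPoint w)) (h : IsRhombic v w m n a b)
    (hg : Int.gcd m n = 1) (ha : a ≠ 0) (hb : b ≠ 0) :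
    ∃ z : RhombicData, (z.lattice : Submodule ℤ _) = Submodule.span ℤ {latPoint v, latPoint w} := by
  have rotate : ∀ {w : ℤ × ℤ} {m n a b : ℤ}, IsRhombic v w m n a b →
      IsRhombic v (-w) (-n) m b (-a) := fun {w m n a b} h => by
    obtain ⟨⟨h1, h2⟩, h3, h4⟩ := h
    exact ⟨⟨by simp; linarith, by simp; linarith⟩, by simp; linarith, by simp; linarith⟩
  have h1 := rotate h
  have h2 := rotate h1
  have h3 := rotate h2
  rw [neg_neg] at h2 h3
  have hred1 : IsReducedPair (latPoint v) (latPoint (-w)) := by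
    rw [latPoint_neg]
    exact hred.neg_right
  have hne : ¬ (m = 0 ∧ n = 0) := by
    rintro ⟨rfl, rfl⟩
    simp at hg
  by_cases c0 : 0 < m ∧ 0 ≤ n
  · exact exists_lattice_eq_of_quadrant hred h hg c0.1 c0.2 ha hb
  by_cases c1 : n < 0 ∧ 0 ≤ m
  · have := exists_lattice_eq_of_quadrant hred1 h1 (by rw [Int.gcd_comm, Int.gcd_neg, hg])
      (by omega) c1.2 hb (neg_ne_zero.2 ha)
    rwa [latPoint_neg, span_pair_neg_right] at this
  by_cases c2 : m < 0 ∧ n ≤ 0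
  · exact exists_lattice_eq_of_quadrant hred h2 (by rw [Int.gcd_neg, Int.neg_gcd, hg])
      (by omega) (by omega) (neg_ne_zero.2 ha) (neg_ne_zero.2 hb)
  · have := exists_lattice_eq_of_quadrant hred1 h3 (by
        rw [neg_neg, Int.gcd_comm, Int.neg_gcd, hg])
      (by omega) (by omega) (neg_ne_zero.2 hb) (by simpa using ha)
    rwa [latPoint_neg, span_pair_neg_right] at this

theorem lattice_surjective : Function.Surjective lattice := by
  rintro ⟨L, hL⟩
  obtain ⟨v, w, hred, rfl⟩ := exists_reduced_basis hL
  obtain ⟨hN, hc⟩ := isReducedPair_latPoint_iff.1 hred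
  have hN0 : 0 < v.1 ^ 2 + v.2 ^ 2 := by linarith [abs_nonneg (v.1 * w.1 + v.2 * w.2)]
  have hlt := abs_lt.1 (show |v.1 * w.1 + v.2 * w.2| < v.1 ^ 2 + v.2 ^ 2 by
    linarith [abs_nonneg (v.1 * w.1 + v.2 * w.2)])
  have hg : 0 < Int.gcd (v.1 + w.1) (v.2 + w.2) := by
    rw [Int.gcd_pos_iff]
    by_contra! h
    nlinarith [h.1, h.2]
  obtain ⟨m, n, hmn, hm, hn⟩ := Int.exists_gcd_one hg
  generalize Int.gcd (v.1 + w.1) (v.2 + w.2) = g at *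
  have hg' : (0 : ℤ) < g := by exact_mod_cast hg
  obtain ⟨r, s, hrs⟩ := Int.isCoprime_iff_gcd_eq_one.2 hmn
  -- `v - w` is orthogonal to `v + w = g(m, n)`, because `v` and `w` have equal length.
  have hperp : (v.1 - w.1) * m + (v.2 - w.2) * n = 0 := by
    refine mul_right_cancel₀ hg'.ne' ?_
    have : ((v.1 - w.1) * m + (v.2 - w.2) * n) * g =
        (v.1 - w.1) * (m * g) + (v.2 - w.2) * (n * g) := by ring
    rw [this, ← hm, ← hn]
    linarith
  -- The vector `v - w`, orthogonal to the primitive `(m, n)`, is an integral multiple of `(-n, m)`;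
  -- the Bézout relation `r m + s n = 1` computes the multiple.
  have hrh : IsRhombic v w m n g (r * (v.2 - w.2) - s * (v.1 - w.1)) := by
    refine ⟨⟨by linarith, by linarith⟩, ?_, ?_⟩
    · linear_combination r * hperp - (v.1 - w.1) * hrs
    · linear_combination s * hperp - (v.2 - w.2) * hrs
  obtain ⟨z, hz⟩ := exists_lattice_eq hred hrh hmn hg'.ne' (fun h0 => by
    obtain ⟨-, h3, h4⟩ := hrh
    rw [h0] at h3 h4
    nlinarith)
  exact ⟨z, Subtype.ext hz⟩

theorem wrDet_lattice (z : RhombicData) : wrDet z.lattice =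
    1 / 2 * (((z.1.1.1 : ℝ) ^ 2 + (z.1.1.2 : ℝ) ^ 2) * (z.1.2.1 * z.1.2.2)) := by
  rw [wrDet, lattice, z.isReducedPair.covolume_eq]
  simp only [latPoint_zero, latPoint_one]
  have h1 := z.isRhombic.det_eq
  have h2 : 2 * ((z.fst.1 : ℝ) * z.snd.2 - z.fst.2 * z.snd.1) =
      -(z.1.2.1 * z.1.2.2 * ((z.1.1.1 : ℝ) ^ 2 + (z.1.1.2 : ℝ) ^ 2)) := by exact_mod_cast h1
  have ha : (0 : ℝ) < z.1.2.1 := by exact_mod_cast z.pos.2.1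
  have hb : (0 : ℝ) < z.1.2.2 := by exact_mod_cast z.pos.2.2
  have h3 : (z.fst.1 : ℝ) * z.snd.2 - z.fst.2 * z.snd.1 =
      -(1 / 2 * (((z.1.1.1 : ℝ) ^ 2 + (z.1.1.2 : ℝ) ^ 2) * (z.1.2.1 * z.1.2.2))) := by linarith
  rw [h3, abs_neg, abs_of_nonneg (by positivity)]

theorem wrMinSq_lattice (z : RhombicData) : wrMinSq z.lattice =
    1 / 4 * (((z.1.1.1 : ℝ) ^ 2 + (z.1.1.2 : ℝ) ^ 2) *
      ((z.1.2.1 : ℝ) ^ 2 + (z.1.2.2 : ℝ) ^ 2)) := by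
  rw [wrMinSq, lattice, z.isReducedPair.latticeMin_eq, norm_sq_latPoint]
  have h1 := z.isRhombic.norm_left
  have h2 : 4 * ((z.fst.1 ^ 2 + z.fst.2 ^ 2 : ℤ) : ℝ) =
      ((z.1.2.1 : ℝ) ^ 2 + (z.1.2.2 : ℝ) ^ 2) * ((z.1.1.1 : ℝ) ^ 2 + (z.1.1.2 : ℝ) ^ 2) := by
    exact_mod_cast h1
  linarith

end RhombicData

/-! ### Parity splitting and the double poles -/

/-- The pairs with `(m, n)` of odd coordinate sum, and those with `(m, n)` both odd. -/
def rhombicOfParity :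
    ({v : ℤ × ℤ // intPoint v ∈ quadrant ∧ Odd (v.1 + v.2) ∧ Int.gcd v.1 v.2 = 1} ×
      {v : ℤ × ℤ // intPoint v ∈ sector ∧ Even v.1 ∧ Even v.2}) ⊕
    ({v : ℤ × ℤ // intPoint v ∈ quadrant ∧ (Odd v.1 ∧ Odd v.2) ∧ Int.gcd v.1 v.2 = 1} ×
      {v : ℤ × ℤ // intPoint v ∈ sector ∧ Even (v.1 + v.2)}) → RhombicData
  | Sum.inl z => ⟨(z.1.1, z.2.1), ⟨z.1.2.1, z.1.2.2.2⟩, z.2.2.1,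
      (z.2.2.2.1.mul_right _).sub (z.2.2.2.2.mul_right _),
      (z.2.2.2.1.mul_right _).add (z.2.2.2.2.mul_right _)⟩
  | Sum.inr z => ⟨(z.1.1, z.2.1), ⟨z.1.2.1, z.1.2.2.2⟩, z.2.2.1, by
      have h1 := z.1.2.2.1
      have h2 := z.2.2.2
      simp only [← Int.not_even_iff_odd] at h1
      simp only [Int.even_add, Int.even_sub, Int.even_mul] at h2 ⊢
      tauto⟩

/-- Modulo `2` the primitive `(m, n)` is nonzero. If `m + n` is odd, integrality forces `a` and `b`
to be even; if `m` and `n` are odd, it says only that `a + b` is even. In each case the condition on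
`(a, b)` no longer involves `(m, n)`, so the sum factors. -/
theorem rhombicOfParity_bijective : Function.Bijective rhombicOfParity := by
  constructor
  · rintro (⟨v, c⟩ | ⟨v, c⟩) (⟨v', c'⟩ | ⟨v', c'⟩) h <;> have h1 := Subtype.ext_iff.1 h <;>
      simp only [rhombicOfParity, Prod.mk.injEq] at h1
    · rw [Subtype.ext h1.1, Subtype.ext h1.2]
    · have hv := v.2.2.1
      rw [h1.1] at hv
      exact absurd (v'.2.2.1.1.add_odd v'.2.2.1.2) (Int.not_even_iff_odd.2 hv)
    · have hv := v'.2.2.1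
      rw [← h1.1] at hv
      exact absurd (v.2.2.1.1.add_odd v.2.2.1.2) (Int.not_even_iff_odd.2 hv)
    · rw [Subtype.ext h1.1, Subtype.ext h1.2]
  · rintro ⟨⟨⟨m, n⟩, a, b⟩, ⟨hq, hg⟩, hs, h1, h2⟩
    have h3 : ¬ (Even m ∧ Even n) := fun h => by
      have := Int.dvd_coe_gcd h.1.two_dvd h.2.two_dvd
      simp only at hg
      rw [hg] at this
      omega
    simp only [Int.even_add, Int.even_sub, Int.even_mul] at h1 h2
    by_cases hodd : Odd (m + n)
    · have h4 := hodd
      rw [← Int.not_even_iff_odd, Int.even_add] at h4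
      exact ⟨Sum.inl ⟨⟨(m, n), hq, hodd, hg⟩, ⟨(a, b), hs, by simp only; tauto,
        by simp only; tauto⟩⟩, rfl⟩
    · have h4 := hodd
      rw [← Int.not_even_iff_odd, Int.even_add] at h4
      exact ⟨Sum.inr ⟨⟨(m, n), hq, by
        simp only [← Int.not_even_iff_odd]
        tauto, hg⟩, ⟨(a, b), hs, by
        rw [Int.even_add]
        tauto⟩⟩, rfl⟩

/-- A quadratic form on the sector gives a double pole for the associated weight on rhombic data. -/
theorem exists_dirPole_rhombicData {F : (Fin 2 → ℝ) → ℝ} (hF : CountingCone sector F) {c : ℝ}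
    (hc : 0 < c) : ∃ l : ℝ, 0 < l ∧ DirPole (fun z : RhombicData =>
      c * (((z.1.1.1 : ℝ) ^ 2 + (z.1.1.2 : ℝ) ^ 2) * F (intPoint z.1.2))) 2 l := by
  obtain ⟨l, hl, h⟩ := countingCone_quadrant.dirPole_coprime_odd_add
  obtain ⟨m, hm, h'⟩ := countingCone_quadrant.dirPole_coprime_odd_odd
  have hpos : ∀ v, intPoint v ∈ sector → 0 ≤ F (intPoint v) := fun v hv => by
    obtain ⟨n, _, hn⟩ := hF.integral v hv
    rw [hn]
    positivity
  have hV := hF.pos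
  -- Each product pairs a primitive sum over the quadrant with a sum over the sector, both with a
  -- simple pole. All residues are positive, so nothing cancels when the two double poles are added.
  have h1 := h.mul hF.dirPole_even_even (fun v => by positivity) (fun v => hpos _ v.2.1)
  have h2 := h'.mul hF.dirPole_even_add (fun v => by positivity) (fun v => hpos _ v.2.1)
  have h3 := (h1.sumElim h2).of_bijective
    (M := fun z : RhombicData => ((z.1.1.1 : ℝ) ^ 2 + (z.1.1.2 : ℝ) ^ 2) * F (intPoint z.1.2))
    rhombicOfParity_bijective (by rintro (z | z) <;> rfl)
  exact ⟨_, by positivity, h3.const_mul (fun z => mul_nonneg (by positivity) (hpos _ z.2.2.1)) hc⟩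

theorem exists_dirPole_wrDet : ∃ l : ℝ, 0 < l ∧ DirPole wrDet 2 l := by
  obtain ⟨l, hl, h⟩ := exists_dirPole_rhombicData countingCone_sector_mul (half_pos one_pos)
  exact ⟨l, hl, h.of_bijective ⟨RhombicData.lattice_injective, RhombicData.lattice_surjective⟩
    fun z => z.wrDet_lattice⟩

theorem exists_dirPole_wrMinSq : ∃ l : ℝ, 0 < l ∧ DirPole wrMinSq 2 l := by
  obtain ⟨l, hl, h⟩ := exists_dirPole_rhombicData countingCone_sector_sq (c := 1 / 4) (by norm_num)
  exact ⟨l, hl, h.of_bijective ⟨RhombicData.lattice_injective, RhombicData.lattice_surjective⟩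
    fun z => z.wrMinSq_lattice⟩

theorem exists_nat_wrDet (L : WRZ2) : ∃ n : ℕ, 0 < n ∧ wrDet L = n := by
  obtain ⟨z, rfl⟩ := RhombicData.lattice_surjective L
  have hpos : 0 < wrDet z.lattice := by
    have h1 : (0 : ℝ) < z.1.1.1 := by exact_mod_cast z.pos.1.1
    have h2 : (0 : ℝ) < z.1.2.1 := by exact_mod_cast z.pos.2.1
    have h3 : (0 : ℝ) < z.1.2.2 := by exact_mod_cast z.pos.2.2
    rw [z.wrDet_lattice]
    positivity
  have h : wrDet z.lattice = ((z.fst.1 * z.snd.2 - z.fst.2 * z.snd.1).natAbs : ℕ) := by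
    rw [wrDet, RhombicData.lattice, z.isReducedPair.covolume_eq, Nat.cast_natAbs]
    simp only [latPoint_zero, latPoint_one]
    push_cast
    rfl
  rw [h] at hpos
  exact ⟨_, by exact_mod_cast hpos, h⟩

theorem exists_nat_wrMinSq (L : WRZ2) : ∃ n : ℕ, 0 < n ∧ wrMinSq L = n := by
  obtain ⟨z, rfl⟩ := RhombicData.lattice_surjective L
  have hpos : 0 < wrMinSq z.lattice := by
    rw [wrMinSq, RhombicData.lattice, z.isReducedPair.latticeMin_eq]
    exact pow_pos z.isReducedPair.norm_pos 2
  have h : wrMinSq z.lattice = ((z.fst.1 ^ 2 + z.fst.2 ^ 2).natAbs : ℕ) := by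
    rw [wrMinSq, RhombicData.lattice, z.isReducedPair.latticeMin_eq, norm_sq_latPoint,
      Nat.cast_natAbs, abs_of_nonneg (by positivity)]
  rw [h] at hpos
  exact ⟨_, by exact_mod_cast hpos, h⟩

theorem theorem1p5 :
    -- the determinant weight enumerator
    (ConvergesRightOf classDet 1 ∧ AnalyticOnNhd ℂ weightD {s : ℂ | 1 < s.re} ∧
      HasGrowthPole (normCoeff classDet) 1 1) ∧
    -- the minima weight enumerator
    (ConvergesRightOf classMin 1 ∧ AnalyticOnNhd ℂ weightM {s : ℂ | 1 < s.re} ∧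
      HasGrowthPole (normCoeff classMin) 1 1) ∧
    -- the zeta function of well-rounded sublattices, by determinant
    (ConvergesRightOf wrDet 1 ∧ AnalyticOnNhd ℂ zetaWR {s : ℂ | 1 < s.re} ∧
      HasGrowthPole (normCoeff wrDet) 2 1) ∧
    -- the zeta function of well-rounded sublattices, by squared minimum
    (ConvergesRightOf wrMinSq 1 ∧ AnalyticOnNhd ℂ zetaWRMin {s : ℂ | 1 < s.re} ∧
      HasGrowthPole (normCoeff wrMinSq) 2 1) := by
  obtain ⟨l₁, hl₁, h₁⟩ := exists_dirPole_classDet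
  obtain ⟨l₂, hl₂, h₂⟩ := exists_dirPole_classMin
  obtain ⟨l₃, hl₃, h₃⟩ := exists_dirPole_wrDet
  obtain ⟨l₄, hl₄, h₄⟩ := exists_dirPole_wrMinSq
  have e₁ := h₁.hasGrowthPole hl₁ one_pos exists_nat_classDet
  have e₂ := h₂.hasGrowthPole hl₂ one_pos exists_nat_classMin
  have e₃ := h₃.hasGrowthPole hl₃ two_pos exists_nat_wrDet
  have e₄ := h₄.hasGrowthPole hl₄ two_pos exists_nat_wrMinSq
  rw [Nat.cast_one] at e₁ e₂
  rw [Nat.cast_ofNat] at e₃ e₄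
  exact ⟨e₁, e₂, e₃, e₄⟩
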